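/- Let $p\ge 1$, $k\ge 0$, let $\mathbb K\in\{\mathbb R,\mathbb C,\mathbb H\}$, $L=\mathbb K^p$, and let $G\subset\mathbb K^{p\times p}=\mathrm{End}_{\mathbb K}(L)$ be the group $SO_p$, $U_p$, $Sp_p$, respectively, where $p$ is assumed to be even if $\mathbb K=\mathbb R$. All subspaces of $\mathbb K^{p\times p}$ carry the Riemannian metric induced by $\langle A,B\rangle=\frac1p\,\mathrm{Re}\,\mathrm{tr}(A^*B)$. Two distinct points $o,q$ of a symmetric space $P$ are called *poles* of $P$ if $s_o=s_q$, where $s_x$ denotes the symmetry of $P$ at $x$, that is, the involutive isometry of $P$ having $x$ as an isolated fixed point. The *midpoint set* of $P$ between $o$ and $q$ is the set of all $\gamma(\frac12)$, where $\gamma:[0,1]\to P$ is a shortest geodesic in $P$ from $o$ to $q$. The *minimal centrioles* of $P$ for the poles $o,q$ are the connected components of this set. A *chain of minimal centrioles* of length $k$ in $G$ with base points consists of subsets $G=P_0\supset P_1\supset\dots\supset P_k$ and points $J_0=I$ and $J_j\in P_j$ $(1\le j\le k)$ such that, for each $0\le j<k$, there is a point $q_j\in P_j$ for which $J_j,q_j$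 are poles of $P_j$ and $P_{j+1}$ is a minimal centriole of $P_j$ for these poles. Let $P_0,\dots,P_k\subset\mathbb K^{p\times p}$ be subsets and $J_1,\dots,J_k\in\mathbb K^{p\times p}$. Then $G=P_0\supset P_1\supset\dots\supset P_k$ with the points $J_0=I,J_1,\dots,J_k$ is a chain of minimal centrioles with base points if and only if the following hold: (a) $J_1,\dots,J_k$ is a $\mathrm{Cl}_k$-representation on $L$ with all $J_j\in G$, that is, there is a homomorphism of $\mathbb R$-algebras $\rho:\mathrm{Cl}_k\to\mathrm{End}_{\mathbb K}(L)$ with $\rho(e_j)=J_j\in G$ for $1\le j\le k$, where $\mathrm{Cl}_k$ is the real algebra generated by $e_1,\dots,e_k$ with the relations $e_ie_j+e_je_i=-2\delta_{ij}$; (b) $P_0=G$ and, for each $1\le j\le k$, $P_j$ is the connected component through $J_j$ of the set $$\hat P_j=\{J\in G:\ J^2=-I,\ JJ_i=-J_iJ\ \text{ for } 1\le i<j\}.$$ In particular, every chain of minimal centrioles with base points determines a $\mathrm{Cl}_k$-representation in $G$ and every $\mathrm{Cl}_k$-representation in $G$ determines exactly one such chain. -/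

import Mathlib

open scoped Matrix.Norms.Frobenius Quaternion ContDiff Topology

namespace Centriole

section Geometry

variable {𝕂 : Type*} [NormedRing 𝕂] [NormedAlgebra ℝ 𝕂] {p : ℕ}

/-- The Riemannian metric on subspaces of the `p × p` matrices over `𝕂 = ℝ, ℂ, ℍ` is induced by
`⟨A, B⟩ = (1/p) Re tr (A* B)`. Its norm is `(1/√p)` times the Frobenius norm
`(∑ i j, ‖A i j‖ ^ 2) ^ (1/2)`. This is the speed of a curve for that metric. -/
noncomputable def speed (c : ℝ → Matrix (Fin p) (Fin p) 𝕂) (t : ℝ) : ℝ :=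
  ‖deriv c t‖ / √(p : ℝ)

/-- The length of the restriction of a curve to `[0, 1]`. -/
noncomputable def curveLength (c : ℝ → Matrix (Fin p) (Fin p) 𝕂) : ℝ :=
  ∫ t in (0 : ℝ)..1, speed c t

/-- `c` restricted to `[0, 1]` is a `C¹` curve in `P` from `o` to `q`. (Every `C¹` curve on
`[0, 1]` extends to a `C¹` curve in the ambient matrix space defined on all of `ℝ`; the values
outside `[0, 1]` are unconstrained and irrelevant. The derivative is allowed to vanish, so every
piecewise `C¹` curve has a reparametrization of this kind, of the same length.) -/
def IsCurveIn (P : Set (Matrix (Fin p) (Fin p) 𝕂)) (o q : Matrix (Fin p) (Fin p) 𝕂)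
    (c : ℝ → Matrix (Fin p) (Fin p) 𝕂) : Prop :=
  ContDiff ℝ 1 c ∧ (∀ t ∈ Set.Icc (0 : ℝ) 1, c t ∈ P) ∧ c 0 = o ∧ c 1 = q

/-- `γ` restricted to `[0, 1]` is a shortest geodesic of `P` from `o` to `q`: a curve in `P` from
`o` to `q`, parametrized proportionally to arc length, of least length among all curves in `P`
from `o` to `q`. -/
def IsShortestGeodesic (P : Set (Matrix (Fin p) (Fin p) 𝕂)) (o q : Matrix (Fin p) (Fin p) 𝕂)
    (γ : ℝ → Matrix (Fin p) (Fin p) 𝕂) : Prop :=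
  IsCurveIn P o q γ ∧
  (∃ v : ℝ, ∀ t ∈ Set.Icc (0 : ℝ) 1, speed γ t = v) ∧
  ∀ c : ℝ → Matrix (Fin p) (Fin p) 𝕂, IsCurveIn P o q c → curveLength γ ≤ curveLength c

/-- The set of midpoints `γ(1/2)` of shortest geodesics `γ` of `P` from `o` to `q`. -/
def midpointSet (P : Set (Matrix (Fin p) (Fin p) 𝕂)) (o q : Matrix (Fin p) (Fin p) 𝕂) :
    Set (Matrix (Fin p) (Fin p) 𝕂) :=
  {m | ∃ γ : ℝ → Matrix (Fin p) (Fin p) 𝕂, IsShortestGeodesic P o q γ ∧ γ (1 / 2) = m}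

/-- `s` restricts to a smooth Riemannian isometry of `P` onto itself which is an involution and
has `o` as an isolated fixed point. (Smooth maps of a compact submanifold `P` are restrictions of
smooth maps of the ambient matrix space. An isometry preserves the norms of tangent vectors of
`P`, that is, the speeds of curves in `P`.) -/
structure IsSymmetryAt (P : Set (Matrix (Fin p) (Fin p) 𝕂)) (o : Matrix (Fin p) (Fin p) 𝕂)
    (s : Matrix (Fin p) (Fin p) 𝕂 → Matrix (Fin p) (Fin p) 𝕂) : Prop where
  smooth : ContDiff ℝ ∞ s
  mapsTo : Set.MapsTo s P P
  involutive : ∀ x ∈ P, s (s x) = x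
  isometry : ∀ c : ℝ → Matrix (Fin p) (Fin p) 𝕂, ContDiff ℝ 1 c →
    (∀ t ∈ Set.Icc (0 : ℝ) 1, c t ∈ P) →
    ∀ t ∈ Set.Icc (0 : ℝ) 1, speed (s ∘ c) t = speed c t
  mem : o ∈ P
  fixed : s o = o
  isolated : ∀ᶠ x in 𝓝[P] o, s x = x → x = o

/-- Two distinct points `o`, `q` of `P` are poles if the symmetries of `P` at `o` and at `q` are
the same map. -/
def ArePoles (P : Set (Matrix (Fin p) (Fin p) 𝕂)) (o q : Matrix (Fin p) (Fin p) 𝕂) : Prop :=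
  o ≠ q ∧ ∃ s : Matrix (Fin p) (Fin p) 𝕂 → Matrix (Fin p) (Fin p) 𝕂,
    IsSymmetryAt P o s ∧ IsSymmetryAt P q s

/-- `C` is a minimal centriole of `P` for the points `o`, `q`: they are poles of `P`, and `C` is a
connected component of the midpoint set between them. -/
def IsMinimalCentriole (P : Set (Matrix (Fin p) (Fin p) 𝕂)) (o q : Matrix (Fin p) (Fin p) 𝕂)
    (C : Set (Matrix (Fin p) (Fin p) 𝕂)) : Prop :=
  ArePoles P o q ∧ ∃ m ∈ midpointSet P o q, C = connectedComponentIn (midpointSet P o q) m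

/-- A chain of minimal centrioles `G = P 0 ⊃ P 1 ⊃ ⋯ ⊃ P k` with base points. The base point of
`P 0` is the identity matrix, the base point of `P (i + 1)` is `J i ∈ P (i + 1)`, and
`P (i + 1)` is a minimal centriole of `P i` for the base point of `P i` and some other pole. -/
def IsCentrioleChain (G : Set (Matrix (Fin p) (Fin p) 𝕂)) {k : ℕ}
    (P : Fin (k + 1) → Set (Matrix (Fin p) (Fin p) 𝕂))
    (J : Fin k → Matrix (Fin p) (Fin p) 𝕂) : Prop :=
  P 0 = G ∧ ∀ i : Fin k, J i ∈ P i.succ ∧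
    ∃ q, IsMinimalCentriole (P i.castSucc)
      ((Fin.cons 1 J : Fin (k + 1) → Matrix (Fin p) (Fin p) 𝕂) i.castSucc) q (P i.succ)

end Geometry

section Clifford

/-- The quadratic form `v ↦ -‖v‖²` on `ℝᵏ`. Its Clifford algebra is generated by `e i`, `i < k`,
with `e i * e j + e j * e i = -2 δ i j`. -/
noncomputable def cliffordForm (k : ℕ) : QuadraticForm ℝ (Fin k → ℝ) :=
  QuadraticMap.weightedSumSquares ℝ (fun _ : Fin k => (-1 : ℝ))

/-- The Clifford algebra `Cl_k`. -/
abbrev Cl (k : ℕ) : Type := CliffordAlgebra (cliffordForm k)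

variable {𝕂 : Type*} [NormedRing 𝕂] [NormedAlgebra ℝ 𝕂] {p : ℕ}

/-- `J` is a `Cl_k`-representation on `𝕂ᵖ`, given by the images of the standard basis vectors:
there is a homomorphism of `ℝ`-algebras `ρ : Cl_k → End_𝕂(𝕂ᵖ)` with `ρ (e i) = J i` (where
`𝕂`-linear endomorphisms of `𝕂ᵖ` are matrices over `𝕂`). -/
def IsCliffordRep {k : ℕ} (J : Fin k → Matrix (Fin p) (Fin p) 𝕂) : Prop :=
  ∃ ρ : Cl k →ₐ[ℝ] Matrix (Fin p) (Fin p) 𝕂,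
    ∀ i : Fin k, ρ (CliffordAlgebra.ι (cliffordForm k) (Pi.single i 1)) = J i

/-- The set of complex structures in `G` that anticommute with all `J l`, `l < i`. -/
def anticommutingStructures (G : Set (Matrix (Fin p) (Fin p) 𝕂)) {k : ℕ}
    (J : Fin k → Matrix (Fin p) (Fin p) 𝕂) (i : Fin k) : Set (Matrix (Fin p) (Fin p) 𝕂) :=
  {X | X ∈ G ∧ X * X = -1 ∧ ∀ l : Fin k, l < i → X * J l = -(J l * X)}

end Clifford

section Groups

/-- `SO_p` as a set of real matrices. -/
def SO (p : ℕ) : Set (Matrix (Fin p) (Fin p) ℝ) := Matrix.specialOrthogonalGroup (Fin p) ℝ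

/-- `U_p` as a set of complex matrices. -/
def U (p : ℕ) : Set (Matrix (Fin p) (Fin p) ℂ) := Matrix.unitaryGroup (Fin p) ℂ

/-- `Sp_p`: quaternionic matrices `A` with `A* A = A A* = 1`. -/
def Sp (p : ℕ) : Set (Matrix (Fin p) (Fin p) ℍ[ℝ]) := unitary (Matrix (Fin p) (Fin p) ℍ[ℝ])

end Groups

end Centriole

/-! The theorem is one step, iterated. Let P be G with o = 1, or the component through o = J_n of
the complex structures in G anticommuting with J_1, ..., J_{n-1}. Shortest geodesics of P from o are
left translates `o * exp (t • w)`, with w in an explicit space T o of skew matrices. Two facts carry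
the step. (i) A pole of o that is joined to o by a shortest geodesic is -o. (ii) The midpoints
between o and -o are the points o * w with w in T o and w² = -1; these are the complex structures in
G in the first case, and those structures that also anticommute with o in the second. So a minimal
centriole is a component of the next set of anticommuting structures, and the Clifford relations
accumulate.

For (ii), a geodesic with exp A = -1 has midpoint o * exp(A/2), and exp(A/2)² = -1. Conversely o *
exp(tπw) is half a great circle of the sphere containing all unitary matrices, hence shortest by
`pi_mul_le_integral_norm_deriv`.

For (i), the symmetry at o reverses geodesics (`symmetry_mul_exp`). This rests on two variational
facts: shortest curves are exponentials (`inner_deriv_eq_of_le_integral_norm`), and short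
exponentials are shortest (`norm_le_integral_norm_deriv`), so isometries map exponentials to
exponentials. For a pole o * exp A, the element z = exp A is then an involution commuting with every
infinitesimal isometry at o given by conjugation. If z were not ±1, primeness of the matrix algebra
would give a nonzero off-diagonal block f of z; `exists_commute_of_signFlip` makes it commute with o
and the J's, and then f - f* is such an infinitesimal isometry not commuting with z.

The scalar rings are treated together through `TraceNorm`, the groups through `IsExpClosed`. -/

namespace Centriole

open Set intervalIntegral

open scoped RealInnerProductSpace

/-! ### Length inequalities and first variation in an inner product space. -/

section InnerProductSpace

variable {E : Type*} [NormedAddCommGroup E] [InnerProductSpace ℝ E]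

/-- A curve joining antipodal points of a sphere of radius `R` has length at least `π * R`. -/
theorem pi_mul_le_integral_norm_deriv {c : ℝ → E} (hc : ContDiff ℝ 1 c) {R : ℝ} (hR : 0 < R)
    (hn : ∀ t ∈ Icc (0 : ℝ) 1, ‖c t‖ = R) (h1 : c 1 = -c 0) :
    Real.pi * R ≤ ∫ t in (0 : ℝ)..1, ‖deriv c t‖ := by
  have hcont : Continuous fun t => ‖deriv c t‖ := (hc.continuous_deriv le_rfl).norm
  have hd : ∀ t, HasDerivAt c (deriv c t) t := fun t =>
    ((hc.differentiable one_ne_zero) t).hasDerivAt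
  have h01 : (0 : ℝ) ∈ Icc (0 : ℝ) 1 := ⟨le_rfl, zero_le_one⟩
  set g : ℝ → ℝ := fun t => ⟪c t, c 0⟫ / R ^ 2 with hg
  have hg' : ∀ t, HasDerivAt g (⟪deriv c t, c 0⟫ / R ^ 2) t := fun t => by
    have := ((hd t).inner ℝ (hasDerivAt_const t (c 0))).div_const (R ^ 2)
    simpa using this
  have hgabs : ∀ t ∈ Icc (0 : ℝ) 1, |g t| ≤ 1 := fun t ht => by
    rw [hg]; simp only
    rw [abs_div, abs_of_pos (by positivity : 0 < R ^ 2), div_le_one (by positivity)]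
    calc |⟪c t, c 0⟫| ≤ ‖c t‖ * ‖c 0‖ := abs_real_inner_le_norm _ _
      _ = R ^ 2 := by rw [hn t ht, hn 0 h01]; ring
  have hg0 : g 0 = 1 := by
    simp only [hg, real_inner_self_eq_norm_sq, hn 0 h01]; field_simp
  have hg1 : g 1 = -1 := by
    simp only [hg, h1, inner_neg_left, real_inner_self_eq_norm_sq, hn 0 h01]; field_simp
  have horth : ∀ t ∈ Ioo (0 : ℝ) 1, ⟪deriv c t, c t⟫ = 0 := fun t ht => by
    have e1 : HasDerivAt (fun t => ⟪c t, c t⟫) (⟪c t, deriv c t⟫ + ⟪deriv c t, c t⟫) t :=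
      (hd t).inner ℝ (hd t)
    have e2 : (fun t => ⟪c t, c t⟫) =ᶠ[𝓝 t] fun _ => R ^ 2 := by
      filter_upwards [Ioo_mem_nhds ht.1 ht.2] with s hs
      rw [real_inner_self_eq_norm_sq, hn s ⟨hs.1.le, hs.2.le⟩]
    have e3 := e1.unique ((hasDerivAt_const t (R ^ 2)).congr_of_eventuallyEq e2)
    rw [real_inner_comm] at e3
    linarith
  have key : ∀ l ∈ Ioo (0 : ℝ) 1, 2 * Real.arcsin l * R ≤ ∫ t in (0 : ℝ)..1, ‖deriv c t‖ := by
    intro l hl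
    -- For l = 1 this is, up to a constant, arc length minus R times the angle from `c 0`. The
    -- factor l < 1 keeps `arcsin` away from ±1, where it is not differentiable; l tends to 1 at the
    -- end.
    set F : ℝ → ℝ := fun t => (∫ s in (0 : ℝ)..t, ‖deriv c s‖) + R * Real.arcsin (l * g t) with hF
    have hlg : ∀ t ∈ Icc (0 : ℝ) 1, |l * g t| < 1 := fun t ht => by
      rw [abs_mul, abs_of_pos hl.1]
      nlinarith [hgabs t ht, hl.1, hl.2, abs_nonneg (g t)]
    have hFd : ∀ t ∈ Icc (0 : ℝ) 1, HasDerivAt F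
        (‖deriv c t‖ + R * (1 / √(1 - (l * g t) ^ 2) * (l * (⟪deriv c t, c 0⟫ / R ^ 2)))) t := by
      intro t ht
      have hh := abs_lt.1 (hlg t ht)
      refine (integral_hasDerivAt_right (hcont.intervalIntegrable _ _)
        hcont.aestronglyMeasurable.stronglyMeasurableAtFilter hcont.continuousAt).add ?_
      exact ((Real.hasDerivAt_arcsin hh.1.ne' hh.2.ne).comp t ((hg' t).const_mul l)).const_mul R
    have hmono : MonotoneOn F (Icc 0 1) := by
      refine monotoneOn_of_deriv_nonneg (convex_Icc 0 1)
        (fun t ht => (hFd t ht).continuousAt.continuousWithinAt)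
        (fun t ht => ((hFd t (interior_subset ht)).differentiableAt).differentiableWithinAt) ?_
      intro t ht
      have htI := interior_subset ht
      rw [interior_Icc] at ht
      rw [(hFd t htI).deriv]
      have hsq : 0 < 1 - (l * g t) ^ 2 := by
        have := hlg t htI
        rw [← sq_lt_one_iff_abs_lt_one] at this
        linarith
      have hs := Real.sqrt_pos.2 hsq
      -- `c 0 - g t • c t` is the component of `c 0` orthogonal to `c t`, and only this component
      -- pairs with the velocity, by `horth`.
      have hnorm : ‖c 0 - g t • c t‖ ≤ R * √(1 - (l * g t) ^ 2) := by
        refine (pow_le_pow_iff_left₀ (norm_nonneg _) (by positivity) two_ne_zero).1 ?_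
        rw [mul_pow, Real.sq_sqrt hsq.le, norm_sub_sq_real, norm_smul, mul_pow, hn t htI,
          hn 0 h01, inner_smul_right, Real.norm_eq_abs, sq_abs]
        have : ⟪c 0, c t⟫ = g t * R ^ 2 := by
          simp only [hg]; rw [real_inner_comm]; field_simp
        rw [this]
        have h2 : l ^ 2 ≤ 1 := by nlinarith [hl.1, hl.2]
        nlinarith [mul_nonneg (mul_nonneg (sq_nonneg (g t)) (sq_nonneg R)) (sub_nonneg.2 h2)]
      have hin : |⟪deriv c t, c 0⟫| ≤ ‖deriv c t‖ * (R * √(1 - (l * g t) ^ 2)) := by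
        have : ⟪deriv c t, c 0⟫ = ⟪deriv c t, c 0 - g t • c t⟫ := by
          rw [inner_sub_right, inner_smul_right, horth t ht]; ring
        rw [this]
        exact (abs_real_inner_le_norm _ _).trans (by gcongr)
      have : R * (1 / √(1 - (l * g t) ^ 2) * (l * (⟪deriv c t, c 0⟫ / R ^ 2))) =
          l * ⟪deriv c t, c 0⟫ / (R * √(1 - (l * g t) ^ 2)) := by
        field_simp
      rw [this]
      have hb : |l * ⟪deriv c t, c 0⟫ / (R * √(1 - (l * g t) ^ 2))| ≤ ‖deriv c t‖ := by
        rw [abs_div, abs_of_pos (by positivity : 0 < R * √(1 - (l * g t) ^ 2)),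
          div_le_iff₀ (by positivity), abs_mul, abs_of_pos hl.1]
        nlinarith [abs_nonneg ⟪deriv c t, c 0⟫, hl.2, hl.1]
      linarith [(abs_le.1 hb).1]
    have := hmono h01 ⟨zero_le_one, le_rfl⟩ zero_le_one
    simp only [hF, hg0, hg1, integral_same, mul_neg, mul_one, Real.arcsin_neg, zero_add] at this
    linarith
  have hlim : Filter.Tendsto (fun l => 2 * Real.arcsin l * R) (𝓝[<] 1)
      (𝓝 (2 * Real.arcsin 1 * R)) := by
    have : Continuous fun l => 2 * Real.arcsin l * R := by fun_prop
    exact this.continuousAt.tendsto.mono_left nhdsWithin_le_nhds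
  have := le_of_tendsto hlim (by
    filter_upwards [Ioo_mem_nhdsLT (zero_lt_one' ℝ)] with l hl using key l hl)
  rw [Real.arcsin_one] at this
  linarith

/-- Du Bois-Reymond: if no variation of the velocity of `γ` along `Φ`, by the derivative of a
function vanishing at both ends, decreases the length, then `⟪γ', Φ⟫` is constant. -/
theorem inner_deriv_eq_of_le_integral_norm {γ Φ : ℝ → E} (hγ : ContDiff ℝ 1 γ)
    (hΦ : Continuous Φ) {v : ℝ} (hv : ∀ t ∈ Icc (0 : ℝ) 1, ‖deriv γ t‖ = v)
    (hmin : ∀ φ : ℝ → ℝ, ContDiff ℝ 1 φ → φ 0 = 0 → φ 1 = 0 →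
      v ≤ ∫ t in (0 : ℝ)..1, ‖deriv γ t + deriv φ t • Φ t‖) :
    ∀ t ∈ Icc (0 : ℝ) 1, ⟪deriv γ t, Φ t⟫ = ⟪deriv γ 0, Φ 0⟫ := by
  have hγc : Continuous (deriv γ) := hγ.continuous_deriv le_rfl
  have hv0 : 0 ≤ v := (hv 0 ⟨le_rfl, zero_le_one⟩) ▸ norm_nonneg _
  set b : ℝ → ℝ := fun t => ⟪deriv γ t, Φ t⟫ with hb
  have hbc : Continuous b := hγc.inner hΦ
  set m : ℝ := ∫ t in (0 : ℝ)..1, b t with hm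
  set β : ℝ → ℝ := fun t => b t - m with hβ
  have hβc : Continuous β := hbc.sub continuous_const
  have hβ0 : ∫ t in (0 : ℝ)..1, β t = 0 := by
    simp only [hβ]
    rw [integral_sub (hbc.intervalIntegrable _ _) (continuous_const.intervalIntegrable _ _)]
    simp [hm]
  set V : ℝ := ∫ t in (0 : ℝ)..1, β t ^ 2 with hV
  set K : ℝ := ∫ t in (0 : ℝ)..1, ‖β t • Φ t‖ ^ 2 with hK
  have hV0 : 0 ≤ V := integral_nonneg zero_le_one fun t _ => sq_nonneg _
  have hK0 : 0 ≤ K := integral_nonneg zero_le_one fun t _ => sq_nonneg _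
  have hψ : ∀ t, HasDerivAt (fun t => ∫ s in (0 : ℝ)..t, β s) (β t) t := fun t =>
    integral_hasDerivAt_right (hβc.intervalIntegrable _ _)
        hβc.aestronglyMeasurable.stronglyMeasurableAtFilter hβc.continuousAt
  have key : ∀ ε : ℝ, 0 ≤ 2 * ε * V + ε ^ 2 * K := by
    -- The test function is ε times the primitive of β, which vanishes at 1 because β has mean zero.
    -- Since the mean of f is at least v, its mean square is at least v²; expanding that square
    -- gives the claim.
    intro ε
    have hφ : ∀ t, HasDerivAt (fun t => ε * ∫ s in (0 : ℝ)..t, β s) (ε * β t) t := fun t =>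
      (hψ t).const_mul ε
    have hφd : deriv (fun t => ε * ∫ s in (0 : ℝ)..t, β s) = fun t => ε * β t :=
      funext fun t => (hφ t).deriv
    have h1 := hmin (fun t => ε * ∫ s in (0 : ℝ)..t, β s)
      (contDiff_one_iff_deriv.2 ⟨fun t => (hφ t).differentiableAt, by
        rw [hφd]; exact continuous_const.mul hβc⟩) (by simp) (by simp [hβ0])
    rw [hφd] at h1
    set f : ℝ → ℝ := fun t => ‖deriv γ t + (ε * β t) • Φ t‖ with hf
    have hfc : Continuous f := by fun_prop
    have h2 : 0 ≤ ∫ t in (0 : ℝ)..1, (f t - v) ^ 2 :=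
      integral_nonneg zero_le_one fun t _ => sq_nonneg _
    have h3 : ∫ t in (0 : ℝ)..1, (f t - v) ^ 2 =
        (∫ t in (0 : ℝ)..1, f t ^ 2) - 2 * v * (∫ t in (0 : ℝ)..1, f t) + v ^ 2 := by
      have : ∀ t, (f t - v) ^ 2 = f t ^ 2 - 2 * v * f t + v ^ 2 := fun t => by ring
      simp_rw [this]
      rw [integral_add, integral_sub, integral_const_mul]
      · simp
      all_goals apply Continuous.intervalIntegrable; fun_prop
    have h4 : ∫ t in (0 : ℝ)..1, f t ^ 2 = v ^ 2 + 2 * ε * V + ε ^ 2 * K := by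
      have e1 : ∫ t in (0 : ℝ)..1, f t ^ 2 = ∫ t in (0 : ℝ)..1,
          (v ^ 2 + 2 * ε * (β t ^ 2) + 2 * ε * m * β t + ε ^ 2 * ‖β t • Φ t‖ ^ 2) := by
        apply integral_congr
        intro t ht
        rw [uIcc_of_le zero_le_one] at ht
        simp only [hf]
        rw [norm_add_sq_real, hv t ht, inner_smul_right, mul_smul, norm_smul ε, mul_pow,
          Real.norm_eq_abs, sq_abs]
        have : ⟪deriv γ t, Φ t⟫ = β t + m := by simp [hβ, hb]
        rw [this]; ring
      rw [e1, integral_add, integral_add, integral_add, integral_const_mul, integral_const_mul,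
        integral_const_mul, hβ0]
      · simp [hV, hK]
      all_goals apply Continuous.intervalIntegrable; fun_prop
    nlinarith
  have hVz : V = 0 := by
    by_contra hne
    have hVp : 0 < V := lt_of_le_of_ne hV0 (Ne.symm hne)
    -- A small negative multiple of V makes the linear term dominate; the 1 guards against K = 0.
    have h := key (-V / (K + 1))
    have e : 2 * (-V / (K + 1)) * V + (-V / (K + 1)) ^ 2 * K =
        -(V ^ 2 * (K + 2)) / (K + 1) ^ 2 := by field_simp; ring
    rw [e] at h
    have : 0 < V ^ 2 * (K + 2) / (K + 1) ^ 2 := by positivity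
    rw [neg_div] at h
    linarith
  have hβz : ∀ t ∈ Icc (0 : ℝ) 1, β t = 0 := by
    by_contra! hcon
    obtain ⟨t, ht, hne⟩ := hcon
    have : 0 < V := integral_pos zero_lt_one (by fun_prop) (fun t _ => sq_nonneg _)
      ⟨t, ht, by positivity⟩
    linarith
  intro t ht
  have e1 := hβz t ht
  have e2 := hβz 0 ⟨le_rfl, zero_le_one⟩
  simp only [hβ, hb] at e1 e2
  linarith

end InnerProductSpace

end Centriole

/-! ### Exponentials and minimizing one-parameter groups in a normed star algebra with trace. -/

namespace Centriole

/-- A trace on a normed star algebra for which the norm is the norm of the inner product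
`tr (star x * y)`. -/
class TraceNorm (M : Type*) [NormedRing M] [NormedAlgebra ℝ M] [StarRing M] where
  /-- The trace. -/
  tr : M →ₗ[ℝ] ℝ
  tr_mul_comm : ∀ x y, tr (x * y) = tr (y * x)
  tr_star : ∀ x, tr (star x) = tr x
  norm_sq_eq : ∀ x, ‖x‖ ^ 2 = tr (star x * x)

section TraceNorm

open Set intervalIntegral
open NormedSpace (exp)
open scoped RealInnerProductSpace
open TraceNorm

variable {M : Type*} [NormedRing M] [NormedAlgebra ℝ M]

theorem hasDerivAt_exp_smul [CompleteSpace M] (w : M) (t : ℝ) :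
    HasDerivAt (fun t : ℝ => exp (t • w)) (exp (t • w) * w) t :=
  hasDerivAt_exp_smul_const w t

theorem hasDerivAt_exp_smul_comp [CompleteSpace M] {φ : ℝ → ℝ} (hφ : ContDiff ℝ 1 φ) (C : M)
    (t : ℝ) : HasDerivAt (fun t => exp (φ t • C)) (deriv φ t • (exp (φ t • C) * C)) t :=
  (hasDerivAt_exp_smul C (φ t)).scomp t ((hφ.differentiable one_ne_zero) t).hasDerivAt

theorem contDiff_exp_smul [CompleteSpace M] (w : M) :
    ContDiff ℝ 1 (fun t : ℝ => exp (t • w)) := by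
  refine contDiff_one_iff_deriv.2 ⟨fun t => (hasDerivAt_exp_smul w t).differentiableAt, ?_⟩
  rw [show deriv (fun t : ℝ => exp (t • w)) = fun t => exp (t • w) * w from
    funext fun t => (hasDerivAt_exp_smul w t).deriv]
  exact (continuous_iff_continuousAt.2 fun t =>
    (hasDerivAt_exp_smul w t).continuousAt).mul continuous_const

theorem exp_mul_exp_neg [CompleteSpace M] (x : M) : exp x * exp (-x) = 1 := by
  let : NormedAlgebra ℚ M := NormedAlgebra.restrictScalars ℚ ℝ M
  rw [← NormedSpace.exp_add_of_commute (Commute.neg_right (Commute.refl x)), add_neg_cancel,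
    NormedSpace.exp_zero]

theorem exp_neg_mul_exp [CompleteSpace M] (x : M) : exp (-x) * exp x = 1 := by
  simpa using exp_mul_exp_neg (-x)

theorem exp_add_smul [CompleteSpace M] (s t : ℝ) (x : M) :
    exp ((s + t) • x) = exp (s • x) * exp (t • x) := by
  let : NormedAlgebra ℚ M := NormedAlgebra.restrictScalars ℚ ℝ M
  rw [add_smul, NormedSpace.exp_add_of_commute]
  exact ((Commute.refl x).smul_left s).smul_right t

theorem mul_exp_of_mul_eq [CompleteSpace M] {a x y : M} (h : a * x = y * a) :
    a * exp x = exp y * a := by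
  let : NormedAlgebra ℚ M := NormedAlgebra.restrictScalars ℚ ℝ M
  exact SemiconjBy.exp_right (show SemiconjBy a x y from h)

theorem exp_conj [CompleteSpace M] {u v : M} (h : v * u = 1) (h' : u * v = 1) (x : M) :
    exp (u * x * v) = u * exp x * v := by
  have : u * exp x = exp (u * x * v) * u := mul_exp_of_mul_eq (by rw [mul_assoc _ v, h, mul_one])
  rw [this, mul_assoc _ u v, h', mul_one]

/-- Curves are constrained only on [0, 1]. One-sided differentiation determines the derivative at
the end points too, so identities valid on [0, 1] may be differentiated there. -/
theorem eqOn_deriv_of_eqOn_Icc {E : Type*} [NormedAddCommGroup E] [NormedSpace ℝ E]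
    {f g : ℝ → E} {a b : ℝ} (hab : a < b) (h : ∀ t ∈ Icc a b, f t = g t) {f' g' : E} {t : ℝ}
    (ht : t ∈ Icc a b) (hf : HasDerivAt f f' t) (hg : HasDerivAt g g' t) : f' = g' := by
  refine ((uniqueDiffOn_Icc hab) t ht).eq_deriv _ hf.hasDerivWithinAt ?_
  exact hg.hasDerivWithinAt.congr h (h t ht)

/-- Solutions of `γ' = γ w` are translates of one-parameter groups. -/
theorem eq_mul_exp_of_hasDerivAt [CompleteSpace M] {γ : ℝ → M} {w : M} {T : ℝ}
    (h : ∀ t ∈ Icc (0 : ℝ) T, HasDerivAt γ (γ t * w) t) :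
    ∀ t ∈ Icc (0 : ℝ) T, γ t = γ 0 * exp (t • w) := by
  have hd : ∀ t ∈ Icc (0 : ℝ) T, HasDerivAt (fun t => γ t * exp (t • (-w))) 0 t := by
    intro t ht
    have := (h t ht).mul (hasDerivAt_exp_smul (-w) t)
    refine this.congr_deriv ?_
    have hc : exp (t • (-w)) * w = w * exp (t • (-w)) :=
      (mul_exp_of_mul_eq (by simp)).symm
    rw [mul_neg, hc, mul_neg, mul_assoc, add_neg_cancel]
  intro t ht
  have := constant_of_has_deriv_right_zero
    (fun t ht => (hd t ht).continuousAt.continuousWithinAt)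
    (fun t ht => (hd t ⟨ht.1, ht.2.le⟩).hasDerivWithinAt) t ht
  simp only [zero_smul, NormedSpace.exp_zero, mul_one] at this
  rw [← this, mul_assoc, smul_neg, exp_neg_mul_exp, mul_one]

/-- Both sides solve γ' = γ w with initial value 1. At π/2 and π the values w and -1 locate
midpoints and antipodes. -/
theorem exp_smul_of_mul_self_eq_neg_one [CompleteSpace M] {w : M} (hw : w * w = -1) {t : ℝ}
    (ht : 0 ≤ t) : exp (t • w) = Real.cos t • (1 : M) + Real.sin t • w := by
  have := eq_mul_exp_of_hasDerivAt (γ := fun t => Real.cos t • (1 : M) + Real.sin t • w)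
    (w := w) (T := t) (fun s _ => by
      refine (((Real.hasDerivAt_cos s).smul_const (1 : M)).add
        ((Real.hasDerivAt_sin s).smul_const w)).congr_deriv ?_
      rw [add_mul, smul_mul_assoc, smul_mul_assoc, one_mul, hw, smul_neg, neg_smul, add_comm])
    t ⟨ht, le_rfl⟩
  simpa using this.symm

theorem exp_mul_eq_self_of_mul_eq_zero [CompleteSpace M] {A f : M} (h : A * f = 0) :
    exp A * f = f := by
  have hd : ∀ t : ℝ, HasDerivAt (fun t : ℝ => exp (t • A) * f) 0 t := fun t => by
    have := (hasDerivAt_exp_smul A t).mul_const f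
    rwa [mul_assoc, h, mul_zero] at this
  have := is_const_of_deriv_eq_zero (fun t => (hd t).differentiableAt) (fun t => (hd t).deriv) 1 0
  simpa using this

theorem eq_zero_of_eventually_exp_smul_eq_one [CompleteSpace M] {v : M}
    (h : ∀ᶠ t : ℝ in 𝓝[>] 0, exp (t • v) = 1) : v = 0 := by
  have h1 : HasDerivWithinAt (fun t : ℝ => exp (t • v)) v (Ioi 0) 0 := by
    simpa using (hasDerivAt_exp_smul v 0).hasDerivWithinAt
  have h2 : HasDerivWithinAt (fun t : ℝ => exp (t • v)) 0 (Ioi 0) 0 :=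
    (hasDerivWithinAt_const 0 _ 1).congr_of_eventuallyEq h (by simp)
  exact (uniqueDiffWithinAt_Ioi (0 : ℝ)).eq_deriv _ h1 h2

theorem commute_of_eventually_exp_smul [CompleteSpace M] {C z : M}
    (h : ∀ᶠ t : ℝ in 𝓝 0, exp (t • C) * z = z * exp (t • C)) : C * z = z * C := by
  have h1 : HasDerivAt (fun t : ℝ => exp (t • C) * z) (C * z) 0 := by
    simpa using (hasDerivAt_exp_smul C 0).mul_const z
  have h2 : HasDerivAt (fun t : ℝ => z * exp (t • C)) (z * C) 0 := by
    simpa using (hasDerivAt_exp_smul C 0).const_mul z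
  exact h1.unique (h2.congr_of_eventuallyEq h)

variable [StarRing M] [TraceNorm M]

/-- The inner product `tr (star x * y)`. -/
noncomputable instance innerProductSpaceOfTraceNorm : InnerProductSpace ℝ M where
  inner x y := tr (star x * y)
  norm_sq_eq_re_inner x := norm_sq_eq x
  conj_inner_symm x y := by
    have := tr_star (star x * y)
    simpa using this
  add_left x y z := by simp [add_mul]
  smul_left x y r := by
    have h := tr_star (star (r • x) * y)
    have h' := tr_star (star x * y)
    simp only [star_mul, star_star, mul_smul_comm, map_smul, smul_eq_mul] at h h'
    simp [← h, h']

theorem inner_eq_tr (x y : M) : ⟪x, y⟫ = tr (star x * y) := rfl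

instance : NormedStarGroup M where
  norm_star_le x := by
    refine (pow_le_pow_iff_left₀ (norm_nonneg _) (norm_nonneg _) two_ne_zero).1 ?_
    rw [norm_sq_eq, norm_sq_eq, star_star, tr_mul_comm]

theorem norm_mul_of_star_mul_self {u : M} (hu : star u * u = 1) (a : M) : ‖u * a‖ = ‖a‖ := by
  refine (pow_left_inj₀ (norm_nonneg _) (norm_nonneg _) two_ne_zero).1 ?_
  rw [norm_sq_eq, norm_sq_eq, star_mul, mul_assoc, ← mul_assoc (star u), hu, one_mul]

theorem norm_mul_of_mul_star_self {u : M} (hu : u * star u = 1) (a : M) : ‖a * u‖ = ‖a‖ := by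
  rw [← norm_star, star_mul, norm_mul_of_star_mul_self (by rwa [star_star]), norm_star]

theorem norm_eq_of_star_mul_self {u v : M} (hu : star u * u = 1) (hv : star v * v = 1) :
    ‖u‖ = ‖v‖ := by
  refine (pow_left_inj₀ (norm_nonneg _) (norm_nonneg _) two_ne_zero).1 ?_
  rw [norm_sq_eq, norm_sq_eq, hu, hv]

theorem star_exp_of_skew {A : M} (hA : star A = -A) : star (exp A) = exp (-A) := by
  let : NormedAlgebra ℚ M := NormedAlgebra.restrictScalars ℚ ℝ M
  rw [NormedSpace.star_exp, hA]

theorem star_smul_of_skew [StarModule ℝ M] {A : M} (hA : star A = -A) (t : ℝ) :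
    star (t • A) = -(t • A) := by
  simp [star_smul, hA]

variable [CompleteSpace M]

theorem star_exp_mul_self {A : M} (hA : star A = -A) : star (exp A) * exp A = 1 := by
  rw [star_exp_of_skew hA, exp_neg_mul_exp]

theorem exp_mul_star_self {A : M} (hA : star A = -A) : exp A * star (exp A) = 1 := by
  rw [star_exp_of_skew hA, exp_mul_exp_neg]

variable [StarModule ℝ M]

/-- A unitary one-parameter group of speed at most `1 / 2` is length minimizing on `[0, 1]`. -/
theorem norm_le_integral_norm_deriv {d : ℝ → M} (hd : ContDiff ℝ 1 d)
    (hu : ∀ t ∈ Icc (0 : ℝ) 1, star (d t) * d t = 1) {A : M} (hA : star A = -A)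
    (hA2 : ‖A‖ ≤ 1 / 2) (h : d 1 = d 0 * exp A) :
    ‖A‖ ≤ ∫ t in (0 : ℝ)..1, ‖deriv d t‖ := by
  have hdc : Continuous (deriv d) := hd.continuous_deriv le_rfl
  have hdd : ∀ t, HasDerivAt d (deriv d t) t := fun t =>
    ((hd.differentiable one_ne_zero) t).hasDerivAt
  set L := ∫ t in (0 : ℝ)..1, ‖deriv d t‖ with hL
  have hL0 : 0 ≤ L := integral_nonneg zero_le_one fun t _ => norm_nonneg _
  refine le_of_forall_pos_le_add fun δ hδ => ?_
  have hLδ : 0 < L + δ := by positivity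
  -- Reparametrization by nearly normalized arc length; δ keeps τ' positive even where d stands
  -- still.
  set τ' : ℝ → ℝ := fun t => (‖deriv d t‖ + δ) / (L + δ) with hτ'
  have hτ'c : Continuous τ' := by fun_prop
  have hτ'pos : ∀ t, 0 < τ' t := fun t => by positivity
  set τ : ℝ → ℝ := fun t => ∫ s in (0 : ℝ)..t, τ' s with hτ
  have hτd : ∀ t, HasDerivAt τ (τ' t) t := fun t =>
    integral_hasDerivAt_right (hτ'c.intervalIntegrable _ _)
        hτ'c.aestronglyMeasurable.stronglyMeasurableAtFilter hτ'c.continuousAt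
  have hτ0 : τ 0 = 0 := by simp [hτ]
  have hτ1 : τ 1 = 1 := by
    simp only [hτ, hτ']
    rw [integral_div, integral_add (hdc.norm.intervalIntegrable _ _)
      (continuous_const.intervalIntegrable _ _), ← hL]
    simp [hLδ.ne']
  set e : ℝ → M := fun t => exp (τ t • (-A)) with he
  have hskew : ∀ t : ℝ, star (t • (-A)) = -(t • (-A)) := fun t =>
    star_smul_of_skew (by rw [star_neg, hA]) t
  have hed : ∀ t, HasDerivAt e (τ' t • (e t * (-A))) t := fun t =>
    (hasDerivAt_exp_smul (-A) (τ t)).scomp t (hτd t)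
  have hec : Continuous e := continuous_iff_continuousAt.2 fun t => (hed t).continuousAt
  have heu : ∀ t, e t * star (e t) = 1 := fun t => exp_mul_star_self (hskew _)
  -- u measures the deviation of d from the one-parameter group run at time τ. It is a loop at `d
  -- 0`, so it stays within m of `d 0`.
  set u : ℝ → M := fun t => d t * e t with hudef
  set u' : ℝ → M := fun t => deriv d t * e t - τ' t • (u t * A) with hu'
  have hud : ∀ t, HasDerivAt u (u' t) t := fun t => by
    refine ((hdd t).mul (hed t)).congr_deriv ?_
    simp only [hu', hudef, mul_smul_comm, mul_neg, smul_neg, mul_assoc, sub_eq_add_neg]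
  have huc : Continuous u := hd.continuous.mul hec
  have hu'c : Continuous u' := by
    simp only [hu']
    exact (hdc.mul hec).sub (hτ'c.smul (huc.mul continuous_const))
  have hu0 : u 0 = d 0 := by simp [hudef, he, hτ0]
  have hu1 : u 1 = d 0 := by
    simp only [hudef, he, hτ1, h, one_smul, mul_assoc, exp_mul_exp_neg, mul_one]
  have huu : ∀ t ∈ Icc (0 : ℝ) 1, star (u t) * u t = 1 := fun t ht => by
    have h1 : star (e t) * e t = 1 := star_exp_mul_self (hskew _)
    simp only [hudef, star_mul]
    rw [mul_assoc, ← mul_assoc (star (d t)), hu t ht, one_mul, h1]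
  set m := ∫ t in (0 : ℝ)..1, ‖u' t‖ with hm
  have hm0 : 0 ≤ m := integral_nonneg zero_le_one fun t _ => norm_nonneg _
  have hum : ∀ t ∈ Icc (0 : ℝ) 1, ‖u t - d 0‖ ≤ m := fun t ht => by
    rw [← hu0, ← integral_eq_sub_of_hasDerivAt (fun s _ => hud s)
      (hu'c.intervalIntegrable _ _)]
    refine (norm_integral_le_integral_norm ht.1).trans ?_
    exact integral_mono_interval le_rfl ht.1 ht.2
      (Filter.Eventually.of_forall fun _ => norm_nonneg _) (hu'c.norm.intervalIntegrable _ _)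
  -- Expand ‖u' + τ' u A‖² ≤ (L + δ)² τ'², replace u by `d 0` in the cross term at a cost of m ‖A‖
  -- ‖u'‖, bound ‖u'‖² below by 2 m τ' ‖u'‖ - m² τ'², and divide by τ'. The remaining inner product
  -- integrates to zero because u is a loop.
  have hpt : ∀ t ∈ Icc (0 : ℝ) 1, ‖A‖ ^ 2 * τ' t + 2 * m * (1 - ‖A‖) * ‖u' t‖ - m ^ 2 * τ' t
      - 2 * ⟪d 0 * star A, u' t⟫ ≤ (L + δ) ^ 2 * τ' t := by
    intro t ht
    have hspeed : ‖deriv d t‖ = ‖u' t + τ' t • (u t * A)‖ := by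
      simp only [hu', sub_add_cancel]
      rw [norm_mul_of_mul_star_self (heu t)]
    have hle : ‖deriv d t‖ ≤ (L + δ) * τ' t := by
      simp only [hτ']
      rw [mul_div_cancel₀ _ hLδ.ne']
      linarith
    have hsq : ‖u' t‖ ^ 2 + 2 * (τ' t * ⟪u' t, u t * A⟫) + (τ' t) ^ 2 * ‖A‖ ^ 2
        ≤ ((L + δ) * τ' t) ^ 2 := by
      have := pow_le_pow_left₀ (norm_nonneg _) hle 2
      rw [hspeed, norm_add_sq_real, inner_smul_right, norm_smul, mul_pow,
        norm_mul_of_star_mul_self (huu t ht), Real.norm_eq_abs, sq_abs] at this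
      exact this
    have hin : ⟪u' t, u t * A⟫ ≥ -(‖u' t‖ * (m * ‖A‖)) - ⟪d 0 * star A, u' t⟫ := by
      have e1 : u t * A = (u t - d 0) * A - d 0 * star A := by
        rw [hA, mul_neg, sub_neg_eq_add, sub_mul, sub_add_cancel]
      have e2 := abs_le.1 (abs_real_inner_le_norm (u' t) ((u t - d 0) * A))
      have e3 : ‖(u t - d 0) * A‖ ≤ m * ‖A‖ :=
        (norm_mul_le _ _).trans (by gcongr; exact hum t ht)
      have e4 : ‖u' t‖ * ‖(u t - d 0) * A‖ ≤ ‖u' t‖ * (m * ‖A‖) := by gcongr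
      rw [e1, inner_sub_right, real_inner_comm (d 0 * star A)]
      linarith [e2.1]
    have hp := hτ'pos t
    refine le_of_mul_le_mul_right ?_ hp
    have h5 : τ' t * ⟪u' t, u t * A⟫ ≥
        τ' t * (-(‖u' t‖ * (m * ‖A‖)) - ⟪d 0 * star A, u' t⟫) := by gcongr
    nlinarith [sq_nonneg (‖u' t‖ - m * τ' t)]
  have hin0 : ∫ t in (0 : ℝ)..1, ⟪d 0 * star A, u' t⟫ = 0 := by
    have hdi : ∀ t, HasDerivAt (fun t => ⟪d 0 * star A, u t⟫) ⟪d 0 * star A, u' t⟫ t := fun t => by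
      simpa using (hasDerivAt_const t (d 0 * star A)).inner ℝ (hud t)
    rw [integral_eq_sub_of_hasDerivAt (fun s _ => hdi s)
      ((continuous_const.inner hu'c).intervalIntegrable _ _), hu0, hu1, sub_self]
  have hτi : ∫ t in (0 : ℝ)..1, τ' t = 1 := hτ1
  have hint := integral_mono_on (μ := MeasureTheory.volume) zero_le_one
    (by apply Continuous.intervalIntegrable; fun_prop)
    (by apply Continuous.intervalIntegrable; fun_prop) hpt
  rw [integral_sub, integral_sub, integral_add, integral_const_mul, integral_const_mul,
    integral_const_mul, integral_const_mul, integral_const_mul, hin0, hτi,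
    ← hm] at hint
  -- Integration leaves ‖A‖² + m² (1 - 2‖A‖) ≤ (L + δ)²; this is where ‖A‖ ≤ 1/2 enters.
  · have : ‖A‖ ^ 2 ≤ (L + δ) ^ 2 := by
      nlinarith [mul_nonneg (sq_nonneg m) (by linarith : (0 : ℝ) ≤ 1 - 2 * ‖A‖)]
    exact (pow_le_pow_iff_left₀ (norm_nonneg _) hLδ.le two_ne_zero).1 this
  all_goals apply Continuous.intervalIntegrable; fun_prop

end TraceNorm

/-! ### Making an off-diagonal block commute with an anticommuting family. -/

section Intertwiner

variable {M : Type*} [Ring M]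

/-- Elements of the `(-1, 1)` block of an involution `z` can be made to commute with an
anticommuting family of complex structures, if for each of them there is an injection of the block
that flips its sign and only its sign. -/
theorem exists_commute_of_signFlip {ι : Type*} {y N : ι → M} {z f : M}
    (hy : ∀ i, y i * y i = -1) (hyy : ∀ i j, i ≠ j → y i * y j = -(y j * y i))
    (hyz : ∀ i, y i * z = z * y i) (hNz : ∀ i, N i * z = z * N i)
    (hN : ∀ i, N i * y i = -(y i * N i)) (hNy : ∀ i j, i ≠ j → N i * y j = y j * N i)
    (hinj : ∀ i g, z * g = -g → N i * g = 0 → g = 0)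
    (hf : f ≠ 0) (hzf : z * f = -f) (hfz : f * z = f) (s : Finset ι) :
    ∃ g, g ≠ 0 ∧ z * g = -g ∧ g * z = g ∧ ∀ i ∈ s, y i * g = g * y i := by
  classical
  induction s using Finset.induction_on with
  | empty => exact ⟨f, hf, hzf, hfz, by simp⟩
  | insert l s hl ih =>
    obtain ⟨g, hg, hzg, hgz, hgs⟩ := ih
    -- As y l has inverse -y l, this is g plus its conjugate by y l, which commutes with y l. If it
    -- vanishes, g anticommutes with y l and the sign flip `N l * g` commutes.
    by_cases h : g - y l * g * y l = 0
    · have hyg : y l * g = -(g * y l) := by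
        have h1 : y l * (g - y l * g * y l) = 0 := by rw [h, mul_zero]
        rw [mul_sub, mul_assoc (y l) g, ← mul_assoc (y l) (y l), hy, neg_one_mul,
          sub_neg_eq_add] at h1
        exact eq_neg_of_add_eq_zero_left h1
      refine ⟨N l * g, fun h0 => hg (hinj l g hzg h0), ?_, by rw [mul_assoc, hgz], ?_⟩
      · rw [← mul_assoc, ← hNz, mul_assoc, hzg, mul_neg]
      · intro i hi
        rcases Finset.mem_insert.1 hi with rfl | hi
        · rw [← mul_assoc, ← neg_eq_iff_eq_neg.2 (hN i), neg_mul, mul_assoc, hyg, mul_neg,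
            neg_neg, mul_assoc]
        · have hne : l ≠ i := fun e => hl (e ▸ hi)
          rw [← mul_assoc, ← hNy l i hne, mul_assoc, hgs i hi, mul_assoc]
    · refine ⟨_, h, ?_, ?_, ?_⟩
      · rw [mul_sub, hzg, ← mul_assoc, ← mul_assoc, ← hyz, mul_assoc (y l) z, hzg, mul_neg,
          neg_mul, neg_sub, sub_neg_eq_add, add_comm, ← sub_eq_add_neg]
      · rw [sub_mul, hgz, mul_assoc _ (y l) z, hyz, ← mul_assoc, mul_assoc (y l) g z, hgz]
      · intro i hi
        by_cases hil : i = l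
        · subst hil
          rw [mul_sub, sub_mul, mul_assoc (y i) g, ← mul_assoc (y i) (y i), hy, neg_one_mul,
            mul_assoc (y i), mul_assoc g, hy, mul_neg_one, mul_neg, sub_neg_eq_add,
            sub_neg_eq_add, add_comm]
        · have his := hgs i ((Finset.mem_insert.1 hi).resolve_left hil)
          rw [mul_sub, sub_mul, his, ← mul_assoc, ← mul_assoc, hyy i l hil, neg_mul,
            mul_assoc (y l) (y i), his, mul_assoc _ (y l) (y i), hyy l i (Ne.symm hil), neg_mul,
            mul_neg]
          simp only [mul_assoc]

end Intertwiner

end Centriole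

/-! ### Geodesics, symmetries, poles and midpoints in sets whose geodesics are exponentials. -/

namespace Centriole

section Geometry

open Set intervalIntegral
open NormedSpace (exp)
open scoped RealInnerProductSpace

section Definitions

variable {E : Type*} [NormedAddCommGroup E] [NormedSpace ℝ E]

/-- `c` restricted to `[0, 1]` is a `C¹` curve in `P` from `o` to `q`. -/
def IsCurveInSpace (P : Set E) (o q : E) (c : ℝ → E) : Prop :=
  ContDiff ℝ 1 c ∧ (∀ t ∈ Icc (0 : ℝ) 1, c t ∈ P) ∧ c 0 = o ∧ c 1 = q

/-- `γ` restricted to `[0, 1]` is a shortest curve of constant speed in `P` from `o` to `q`. -/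
def IsMinimizingGeodesic (P : Set E) (o q : E) (γ : ℝ → E) : Prop :=
  IsCurveInSpace P o q γ ∧ (∃ v : ℝ, ∀ t ∈ Icc (0 : ℝ) 1, ‖deriv γ t‖ = v) ∧
  ∀ c, IsCurveInSpace P o q c →
    ∫ t in (0 : ℝ)..1, ‖deriv γ t‖ ≤ ∫ t in (0 : ℝ)..1, ‖deriv c t‖

/-- The midpoints of the minimizing geodesics of `P` from `o` to `q`. -/
def geodesicMidpoints (P : Set E) (o q : E) : Set E :=
  {m | ∃ γ, IsMinimizingGeodesic P o q γ ∧ γ (1 / 2) = m}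

/-- `s` restricts to an involutive isometry of `P` with isolated fixed point `o`. -/
structure IsGeodesicSymmetryAt (P : Set E) (o : E) (s : E → E) : Prop where
  smooth : ContDiff ℝ ∞ s
  mapsTo : MapsTo s P P
  involutive : ∀ x ∈ P, s (s x) = x
  isometry : ∀ c : ℝ → E, ContDiff ℝ 1 c → (∀ t ∈ Icc (0 : ℝ) 1, c t ∈ P) →
    ∀ t ∈ Icc (0 : ℝ) 1, ‖deriv (s ∘ c) t‖ = ‖deriv c t‖
  mem : o ∈ P
  fixed : s o = o
  isolated : ∀ᶠ x in 𝓝[P] o, s x = x → x = o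

/-- `o` and `q` are distinct and have a common symmetry. -/
def AreSymmetryPoles (P : Set E) (o q : E) : Prop :=
  o ≠ q ∧ ∃ s, IsGeodesicSymmetryAt P o s ∧ IsGeodesicSymmetryAt P q s

end Definitions

theorem mul_left_cancel_of_star_mul_self {M : Type*} [Ring M] [StarRing M] {a x y : M}
    (ha : star a * a = 1)
    (h : a * x = a * y) : x = y := by
  have := congr_arg (star a * ·) h
  simpa [← mul_assoc, ha] using this

variable {M : Type*} [NormedRing M] [NormedAlgebra ℝ M]

theorem hasDerivAt_mul_exp_smul [CompleteSpace M] (o w : M) (t : ℝ) :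
    HasDerivAt (fun t : ℝ => o * exp (t • w)) (o * exp (t • w) * w) t := by
  rw [mul_assoc]
  exact (hasDerivAt_exp_smul w t).const_mul o

theorem contDiff_mul_exp_smul [CompleteSpace M] (o w : M) :
    ContDiff ℝ 1 (fun t : ℝ => o * exp (t • w)) :=
  contDiff_const.mul (contDiff_exp_smul w)

variable [StarRing M] [TraceNorm M]

/-- Shortest geodesics have constant momentum along directions in which they can be varied. -/
theorem IsMinimizingGeodesic.inner_deriv_eq {P : Set M} {a b : M} {γ : ℝ → M}
    (h : IsMinimizingGeodesic P a b γ) {Φ : ℝ → M} (hΦ : Continuous Φ)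
    (hvar : ∀ φ : ℝ → ℝ, ContDiff ℝ 1 φ → φ 0 = 0 → φ 1 = 0 → ∃ c, IsCurveInSpace P a b c ∧
      ∀ t ∈ Icc (0 : ℝ) 1, ‖deriv c t‖ = ‖deriv γ t + deriv φ t • Φ t‖) :
    ∀ t ∈ Icc (0 : ℝ) 1, ⟪deriv γ t, Φ t⟫ = ⟪deriv γ 0, Φ 0⟫ := by
  obtain ⟨hγ, ⟨v, hv⟩, hmin⟩ := h
  refine inner_deriv_eq_of_le_integral_norm hγ.1 hΦ hv fun φ hφ h0 h1 => ?_
  obtain ⟨c, hc, hcd⟩ := hvar φ hφ h0 h1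
  have hle := hmin c hc
  have e1 : ∫ t in (0 : ℝ)..1, ‖deriv γ t‖ = v := by
    rw [integral_congr (g := fun _ => v)]
    · simp
    · rw [uIcc_of_le zero_le_one]; exact hv
  have e2 : ∫ t in (0 : ℝ)..1, ‖deriv c t‖ =
      ∫ t in (0 : ℝ)..1, ‖deriv γ t + deriv φ t • Φ t‖ := by
    apply integral_congr
    rw [uIcc_of_le zero_le_one]; exact hcd
  rwa [e1, e2] at hle

/-- `P` consists of unitary matrices, `T a` consists of the left translates to `1` of tangent
vectors of `P` at `a`, and the geodesics of `P` are left translates of one-parameter groups. -/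
structure HasExpGeodesics (P : Set M) (T : M → Submodule ℝ M) : Prop where
  star_mul_self : ∀ a ∈ P, star a * a = 1
  skew : ∀ a ∈ P, ∀ w ∈ T a, star w = -w
  exp_mem : ∀ a ∈ P, ∀ w ∈ T a, a * exp w ∈ P
  geodesic : ∀ a ∈ P, ∀ b γ, IsMinimizingGeodesic P a b γ →
    ∃ w ∈ T a, ∀ t ∈ Icc (0 : ℝ) 1, γ t = a * exp (t • w)

namespace HasExpGeodesics

variable {P : Set M}
  {T : M → Submodule ℝ M}

variable [CompleteSpace M]

theorem norm_deriv_mul_exp_smul (hP : HasExpGeodesics P T) {o w : M} (ho : o ∈ P)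
    (hw : w ∈ T o) (t : ℝ) : ‖deriv (fun t : ℝ => o * exp (t • w)) t‖ = ‖w‖ := by
  rw [(hasDerivAt_mul_exp_smul o w t).deriv]
  exact norm_mul_of_star_mul_self
    (hP.star_mul_self _ (hP.exp_mem o ho _ ((T o).smul_mem t hw))) w

theorem tendsto_mul_exp_smul (o w : M) :
    Filter.Tendsto (fun t : ℝ => o * exp (t • w)) (𝓝 0) (𝓝 o) := by
  have := (contDiff_mul_exp_smul o w).continuous.tendsto 0
  rw [zero_smul, NormedSpace.exp_zero, mul_one] at this
  exact this

theorem eq_of_forall_mul_exp_smul_eq {o v w : M} (ho : star o * o = 1)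
    (h : ∀ t : ℝ, 0 ≤ t → o * exp (t • v) = o * exp (t • w)) : v = w := by
  have h1 := hasDerivAt_mul_exp_smul o v 0
  have h2 := hasDerivAt_mul_exp_smul o w 0
  have := eqOn_deriv_of_eqOn_Icc zero_lt_one (fun t ht => h t ht.1) ⟨le_rfl, zero_le_one⟩ h1 h2
  simp only [zero_smul, NormedSpace.exp_zero, mul_one] at this
  exact mul_left_cancel_of_star_mul_self ho this

/-- The midpoints between `o` and `-o` are the translates of the complex structures in the tangent
space. -/
theorem geodesicMidpoints_neg (hP : HasExpGeodesics P T) {o : M} (ho : o ∈ P)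
    (hhalf : ∀ A ∈ T o, exp A = -1 → exp ((1 / 2 : ℝ) • A) ∈ T o) :
    geodesicMidpoints P o (-o) = {X | ∃ w ∈ T o, w * w = -1 ∧ X = o * w} := by
  have hou := hP.star_mul_self o ho
  ext X
  constructor
  · rintro ⟨γ, hγ, rfl⟩
    obtain ⟨A, hA, hγA⟩ := hP.geodesic o ho _ γ hγ
    have hA1 : exp A = -1 := by
      refine mul_left_cancel_of_star_mul_self hou ?_
      have := hγA 1 ⟨zero_le_one, le_rfl⟩
      rw [one_smul, hγ.1.2.2.2] at this
      rw [← this, mul_neg, mul_one]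
    refine ⟨_, hhalf A hA hA1, ?_, hγA _ ⟨by norm_num, by norm_num⟩⟩
    rw [← exp_add_smul, add_halves, one_smul, hA1]
  · rintro ⟨w, hw, hww, rfl⟩
    have hskew := hP.skew o ho w hw
    have hwu : star w * w = 1 := by rw [hskew, neg_mul, hww, neg_neg]
    have hπ : ∀ t : ℝ, t • (Real.pi • w) = (t * Real.pi) • w := fun t => smul_smul _ _ _
    have hπw : Real.pi • w ∈ T o := (T o).smul_mem _ hw
    refine ⟨fun t => o * exp (t • (Real.pi • w)), ⟨⟨contDiff_mul_exp_smul _ _,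
      fun t _ => hP.exp_mem o ho _ ((T o).smul_mem t hπw), by simp, ?_⟩, ?_, ?_⟩, ?_⟩
    · simp only [hπ, one_mul]
      rw [exp_smul_of_mul_self_eq_neg_one hww Real.pi_pos.le]
      simp
    · exact ⟨‖Real.pi • w‖, fun t _ => by
        rw [hP.norm_deriv_mul_exp_smul ho hπw]⟩
    -- All elements of P lie on the sphere of radius ‖w‖ about 0, so the bound for antipodal points
    -- applies to every competitor.
    · intro c hc
      obtain ⟨hcC, hcP, hc0, hc1⟩ := hc
      simp_rw [hP.norm_deriv_mul_exp_smul ho hπw]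
      rw [integral_const, sub_zero, one_smul, norm_smul, Real.norm_of_nonneg Real.pi_pos.le]
      by_cases hw0 : ‖w‖ = 0
      · rw [hw0, mul_zero]
        exact integral_nonneg zero_le_one fun t _ => norm_nonneg _
      refine pi_mul_le_integral_norm_deriv hcC (lt_of_le_of_ne (norm_nonneg _) (Ne.symm hw0))
        (fun t ht => norm_eq_of_star_mul_self (hP.star_mul_self _ (hcP t ht)) hwu) ?_
      rw [hc0, hc1]
    · simp only [hπ]
      rw [exp_smul_of_mul_self_eq_neg_one hww (by positivity),
        show 1 / 2 * Real.pi = Real.pi / 2 by ring]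
      simp

variable [StarModule ℝ M]

/-- Short pieces of the image of a geodesic under an involutive isometry are geodesics. -/
theorem exists_deriv_image_eq (hP : HasExpGeodesics P T) {o q : M}
    {s : M → M} (hs : IsGeodesicSymmetryAt P q s) {w : M} (ho : o ∈ P) (hw : w ∈ T o) {h : ℝ}
    (hh : 0 < h) (hhw : ‖h • w‖ ≤ 1 / 2) (t₀ : ℝ) :
    ∃ w' ∈ T (s (o * exp (t₀ • w))), ∀ t ∈ Icc t₀ (t₀ + h),
      deriv (fun t : ℝ => s (o * exp (t • w))) t = s (o * exp (t • w)) * w' := by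
  set γ : ℝ → M := fun t => o * exp (t • w) with hγ
  have hγP : ∀ t, γ t ∈ P := fun t => hP.exp_mem o ho _ ((T o).smul_mem t hw)
  set δ : ℝ → M := fun u => γ t₀ * exp (u • (h • w)) with hδ
  have hδγ : ∀ u, δ u = γ (t₀ + u * h) := fun u => by
    simp only [hδ, hγ, exp_add_smul, mul_assoc, smul_smul]
  have hskew : star (h • w) = -(h • w) := star_smul_of_skew (hP.skew o ho w hw) h
  have hδP : ∀ u, δ u ∈ P := fun u => hδγ u ▸ hγP _
  have hδspeed : ∀ u, ‖deriv δ u‖ = ‖h • w‖ := fun u => by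
    simp only [hδ]
    rw [(hasDerivAt_mul_exp_smul _ _ u).deriv]
    rw [norm_mul_of_star_mul_self (hP.star_mul_self _ (hδP u))]
  have hδC : ContDiff ℝ 1 δ := contDiff_mul_exp_smul _ _
  have hsC : ContDiff ℝ 1 s := hs.smooth.of_le (by exact_mod_cast le_top)
  have hiso : ∀ u ∈ Icc (0 : ℝ) 1, ‖deriv (s ∘ δ) u‖ = ‖deriv δ u‖ :=
    hs.isometry δ hδC fun u _ => hδP u
  -- A competitor c for `s ∘ δ` is mapped by s to a curve of the same length with the end points of
  -- δ, and δ is short enough to be shortest among unitary curves.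
  have hgeo : IsMinimizingGeodesic P (s (γ t₀)) (s (δ 1)) (s ∘ δ) := by
    refine ⟨⟨hsC.comp hδC, fun u _ => hs.mapsTo (hδP u), by simp [hδ], rfl⟩,
      ⟨_, fun u hu => (hiso u hu).trans (hδspeed u)⟩, fun c hc => ?_⟩
    obtain ⟨hcC, hcP, hc0, hc1⟩ := hc
    have e1 : ∫ t in (0 : ℝ)..1, ‖deriv (s ∘ δ) t‖ = ∫ _ in (0 : ℝ)..1, ‖h • w‖ := by
      apply integral_congr
      rw [uIcc_of_le zero_le_one]
      exact fun u hu => (hiso u hu).trans (hδspeed u)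
    have e2 : ∫ t in (0 : ℝ)..1, ‖deriv (s ∘ c) t‖ = ∫ t in (0 : ℝ)..1, ‖deriv c t‖ := by
      apply integral_congr
      rw [uIcc_of_le zero_le_one]
      exact hs.isometry c hcC hcP
    rw [e1, ← e2, integral_const, sub_zero, one_smul]
    refine norm_le_integral_norm_deriv (hsC.comp hcC)
      (fun t ht => hP.star_mul_self _ (hs.mapsTo (hcP t ht))) hskew hhw ?_
    simp only [Function.comp_apply, hc0, hc1, hs.involutive _ (hγP t₀), hs.involutive _ (hδP 1)]
    simp [hδ]
  obtain ⟨w₁, hw₁, hw₁'⟩ := hP.geodesic _ (hs.mapsTo (hγP t₀)) _ _ hgeo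
  refine ⟨h⁻¹ • w₁, Submodule.smul_mem _ _ hw₁, fun t ht => ?_⟩
  have hu : (t - t₀) / h ∈ Icc (0 : ℝ) 1 :=
    ⟨div_nonneg (by linarith [ht.1]) hh.le, (div_le_one hh).2 (by linarith [ht.2])⟩
  have htu : t₀ + (t - t₀) / h * h = t := by field_simp; ring
  have hσd : HasDerivAt (fun t => s (γ t)) (deriv (fun t => s (γ t)) t) t :=
    ((hsC.comp (contDiff_mul_exp_smul o w)).differentiable one_ne_zero t).hasDerivAt
  have hl : HasDerivAt (fun u : ℝ => t₀ + u * h) h ((t - t₀) / h) := by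
    simpa using ((hasDerivAt_id ((t - t₀) / h)).mul_const h).const_add t₀
  have h1 : HasDerivAt (s ∘ δ) (h • deriv (fun t => s (γ t)) t) ((t - t₀) / h) := by
    have e : s ∘ δ = (fun t => s (γ t)) ∘ fun u => t₀ + u * h := by
      funext u; simp [hδγ]
    rw [e]
    exact HasDerivAt.scomp _ (by rw [htu]; exact hσd) hl
  have h2 := eqOn_deriv_of_eqOn_Icc zero_lt_one hw₁' hu h1 (hasDerivAt_mul_exp_smul _ _ _)
  rw [← hw₁' _ hu, Function.comp_apply, hδγ, htu] at h2
  rw [mul_smul_comm, ← h2, smul_smul, inv_mul_cancel₀ hh.ne', one_smul]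

/-- The image of a geodesic under an involutive isometry is a geodesic. -/
theorem exists_image_eq_mul_exp (hP : HasExpGeodesics P T) {o : M}
    {s : M → M} (hs : IsGeodesicSymmetryAt P o s) {w : M} (hw : w ∈ T o) :
    ∃ w' ∈ T o, ∀ t : ℝ, 0 ≤ t → s (o * exp (t • w)) = o * exp (t • w') := by
  have ho := hs.mem
  set h : ℝ := 1 / (2 * (‖w‖ + 1)) with hh
  have hpos : 0 < h := by positivity
  have hhw : ‖h • w‖ ≤ 1 / 2 := by
    rw [norm_smul, Real.norm_of_nonneg hpos.le, hh, div_mul_eq_mul_div, div_le_div_iff₀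
      (by positivity) two_pos]
    linarith
  set σ : ℝ → M := fun t => s (o * exp (t • w)) with hσ
  have hσP : ∀ t, σ t ∈ P := fun t => hs.mapsTo (hP.exp_mem o ho _ ((T o).smul_mem t hw))
  have hσ0 : σ 0 = o := by simp [hσ, hs.fixed]
  have hloc := hP.exists_deriv_image_eq hs ho hw hpos hhw
  obtain ⟨w', hw', hw'd⟩ := hloc 0
  have hw'o : w' ∈ T o := by simpa [hs.fixed] using hw'
  refine ⟨w', hw'o, ?_⟩
  have hall : ∀ n : ℕ, ∀ t ∈ Icc (0 : ℝ) (n * h), deriv σ t = σ t * w' := by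
    intro n
    induction n with
    | zero =>
      intro t ht
      simp only [Nat.cast_zero, zero_mul] at ht
      exact hw'd t ⟨ht.1, by linarith [ht.2]⟩
    | succ n ih =>
      intro t ht
      rcases le_total t (n * h) with hle | hle
      · exact ih t ⟨ht.1, hle⟩
      -- Consecutive pieces share the velocity at their common point, so their generators agree.
      · obtain ⟨w₂, -, hw₂⟩ := hloc (n * h)
        have e1 := hw₂ (n * h) ⟨le_rfl, by linarith⟩
        have e2 := ih (n * h) ⟨by positivity, le_rfl⟩
        have e3 : w₂ = w' :=
          mul_left_cancel_of_star_mul_self (hP.star_mul_self _ (hσP (n * h))) (e1.symm.trans e2)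
        rw [← e3]
        refine hw₂ t ⟨hle, ?_⟩
        have := ht.2
        push_cast at this
        linarith
  intro t ht
  obtain ⟨n, hn⟩ := exists_nat_ge (t / h)
  rw [div_le_iff₀ hpos] at hn
  have hσd : ∀ t, HasDerivAt σ (deriv σ t) t := fun t =>
    (((hs.smooth.of_le (by exact_mod_cast le_top : (1 : WithTop ℕ∞) ≤ ∞)).comp
      (contDiff_mul_exp_smul o w)).differentiable one_ne_zero t).hasDerivAt
  have := eq_mul_exp_of_hasDerivAt (γ := σ) (w := w') (T := n * h)
    (fun t ht => hall n t ht ▸ hσd t) t ⟨ht, hn⟩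
  rwa [hσ0] at this

/-- The symmetry at `o` reverses the geodesics through `o`. -/
theorem symmetry_mul_exp (hP : HasExpGeodesics P T) {o : M} {s : M → M}
    (hs : IsGeodesicSymmetryAt P o s) {w : M} (hw : w ∈ T o) : s (o * exp w) = o * exp (-w) := by
  have ho := hs.mem
  have hou := hP.star_mul_self o ho
  have hsd : HasFDerivAt s (fderiv ℝ s o) o :=
    (hs.smooth.differentiable (by simp) o).hasFDerivAt
  set D := fderiv ℝ s o with hD
  have hDw : ∀ v ∈ T o, ∀ v', (∀ t : ℝ, 0 ≤ t → s (o * exp (t • v)) = o * exp (t • v')) →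
      D (o * v) = o * v' := by
    intro v hv v' hv'
    have h1 : HasDerivAt (fun t : ℝ => s (o * exp (t • v))) (D (o * v)) 0 := by
      have e := hasDerivAt_mul_exp_smul o v 0
      simp only [zero_smul, NormedSpace.exp_zero, mul_one] at e
      exact HasFDerivAt.comp_hasDerivAt (0 : ℝ) (by simpa using hsd) e
    have h2 := hasDerivAt_mul_exp_smul o v' 0
    simp only [zero_smul, NormedSpace.exp_zero, mul_one] at h2
    exact eqOn_deriv_of_eqOn_Icc zero_lt_one (fun t ht => hv' t ht.1) ⟨le_rfl, zero_le_one⟩ h1 h2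
  obtain ⟨w', hw', hww'⟩ := hP.exists_image_eq_mul_exp hs hw
  obtain ⟨w'', hw'', hww''⟩ := hP.exists_image_eq_mul_exp hs hw'
  have hback : w'' = w := by
    refine eq_of_forall_mul_exp_smul_eq hou fun t ht => ?_
    rw [← hww'' t ht, ← hww' t ht, hs.involutive _ (hP.exp_mem o ho _ ((T o).smul_mem t hw))]
  -- The differential of s swaps the directions w and w', so it fixes their sum. The geodesic in
  -- that direction is then fixed pointwise, and isolatedness of o forces w + w' = 0.
  have hv : w + w' ∈ T o := (T o).add_mem hw hw'
  obtain ⟨v', hv', hvv'⟩ := hP.exists_image_eq_mul_exp hs hv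
  have hfix : v' = w + w' := by
    refine mul_left_cancel_of_star_mul_self hou ?_
    rw [← hDw _ hv v' hvv', mul_add, map_add, hDw w hw w' hww', hDw w' hw' w'' hww'', hback,
      add_comm]
  have hzero : w + w' = 0 := by
    apply eq_zero_of_eventually_exp_smul_eq_one
    have ht : Filter.Tendsto (fun t : ℝ => o * exp (t • (w + w'))) (𝓝[>] 0) (𝓝[P] o) :=
      tendsto_nhdsWithin_iff.2
        ⟨(tendsto_mul_exp_smul o _).mono_left nhdsWithin_le_nhds,
          Filter.Eventually.of_forall fun t => hP.exp_mem o ho _ ((T o).smul_mem t hv)⟩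
    filter_upwards [ht.eventually hs.isolated, self_mem_nhdsWithin] with t ht' (ht0 : 0 < t)
    refine mul_left_cancel_of_star_mul_self hou ?_
    rw [mul_one]
    exact ht' (by rw [hvv' t ht0.le, hfix])
  have := hww' 1 zero_le_one
  rwa [one_smul, one_smul, eq_neg_of_add_eq_zero_right hzero] at this

/-- A pole `q = o * exp A` of `o` differs from `o` by an involution which commutes with the
infinitesimal isometries of `P` fixing `o`. -/
theorem exists_of_areSymmetryPoles (hP : HasExpGeodesics P T) {o q : M}
    (h : AreSymmetryPoles P o q) (hm : (geodesicMidpoints P o q).Nonempty) :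
    ∃ A ∈ T o, q = o * exp A ∧ exp A * exp A = 1 ∧
      ∀ C, (∀ t : ℝ, ∀ B ∈ T o, exp (t • C) * B * exp (-(t • C)) ∈ T o) →
        C * exp A = exp A * C := by
  obtain ⟨-, s, hso, hsq⟩ := h
  have ho := hso.mem
  have hou := hP.star_mul_self o ho
  obtain ⟨m, γ, hγ, -⟩ := hm
  obtain ⟨A, hA, hγA⟩ := hP.geodesic o ho q γ hγ
  have hq : q = o * exp A := by
    rw [← hγ.1.2.2.2, hγA 1 ⟨zero_le_one, le_rfl⟩, one_smul]
  -- The symmetry s reverses the geodesic from o to q, and also fixes q.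
  have hinv : exp (-A) = exp A := by
    refine mul_left_cancel_of_star_mul_self hou ?_
    rw [← hP.symmetry_mul_exp hso hA, ← hq, hsq.fixed]
  refine ⟨A, hA, hq, ?_, fun C hC => commute_of_eventually_exp_smul ?_⟩
  · nth_rewrite 1 [← hinv]
    exact exp_neg_mul_exp A
  have hconj : ∀ (t : ℝ) (B : M), exp (exp (t • C) * B * exp (-(t • C))) =
      exp (t • C) * exp B * exp (-(t • C)) := fun t B =>
    exp_conj (exp_neg_mul_exp _) (exp_mul_exp_neg _) B
  -- Conjugating by exp(tC) moves q through points of P that tend to q as t tends to 0. Each is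
  -- fixed by s, since its factor is again an involution; isolatedness of q makes the motion trivial
  -- for small t.
  have hcont : Filter.Tendsto (fun t : ℝ => o * (exp (t • C) * exp A * exp (-(t • C)))) (𝓝 0)
      (𝓝[P] q) := by
    refine tendsto_nhdsWithin_iff.2 ⟨?_, Filter.Eventually.of_forall fun t => ?_⟩
    · have hc : Continuous fun t : ℝ => o * (exp (t • C) * exp A * exp (-(t • C))) := by
        have h1 := (contDiff_exp_smul C).continuous
        have h2 := (contDiff_exp_smul (-C)).continuous
        simp only [smul_neg] at h2
        exact continuous_const.mul ((h1.mul continuous_const).mul h2)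
      have := hc.tendsto 0
      simpa [hq] using this
    · rw [← hconj]
      exact hP.exp_mem o ho _ (hC t A hA)
  filter_upwards [hcont.eventually hsq.isolated] with t ht
  have hfix := ht (by
    rw [← hconj, hP.symmetry_mul_exp hso (hC t A hA), hconj]
    rw [show -(exp (t • C) * A * exp (-(t • C))) = exp (t • C) * (-A) * exp (-(t • C)) by
      rw [mul_neg, neg_mul], hconj, hinv])
  rw [hq] at hfix
  have := mul_left_cancel_of_star_mul_self hou hfix
  calc exp (t • C) * exp A = exp (t • C) * exp A * exp (-(t • C)) * exp (t • C) := by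
        rw [mul_assoc _ (exp (-(t • C))), exp_neg_mul_exp, mul_one]
    _ = exp A * exp (t • C) := by rw [this]

/-- The minimal centrioles of `P` for the base point `o` are the components of the set of midpoints
between `o` and `-o`. -/
theorem exists_component_geodesicMidpoints_iff [Nontrivial M] (hP : HasExpGeodesics P T) {o : M}
    (ho : o ∈ P) {N : Set M} (hN : N = {X | ∃ w ∈ T o, w * w = -1 ∧ X = o * w})
    (hhalf : ∀ A ∈ T o, exp A = -1 → exp ((1 / 2 : ℝ) • A) ∈ T o)
    (hcent : ∀ A ∈ T o, exp A * exp A = 1 → exp A ≠ 1 →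
      (∀ C, (∀ t : ℝ, ∀ B ∈ T o, exp (t • C) * B * exp (-(t • C)) ∈ T o) →
        C * exp A = exp A * C) → exp A = -1)
    (hsymm : ∃ s, IsGeodesicSymmetryAt P o s ∧ (-o ∈ P → IsGeodesicSymmetryAt P (-o) s))
    {J : M} {C : Set M} :
    (J ∈ C ∧ ∃ q, (AreSymmetryPoles P o q ∧
      ∃ m ∈ geodesicMidpoints P o q, C = connectedComponentIn (geodesicMidpoints P o q) m)) ↔
        J ∈ N ∧ C = connectedComponentIn N J := by
  have hmid := hP.geodesicMidpoints_neg ho hhalf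
  rw [← hN] at hmid
  constructor
  · rintro ⟨hJ, q, hpoles, m, hm, rfl⟩
    obtain ⟨A, hA, hqA, hAA, hAC⟩ := hP.exists_of_areSymmetryPoles hpoles ⟨m, hm⟩
    have hne : exp A ≠ 1 := fun h => hpoles.1 (by rw [hqA, h, mul_one])
    have hq : q = -o := by rw [hqA, hcent A hA hAA hne hAC, mul_neg, mul_one]
    subst hq
    rw [hmid] at hJ ⊢
    exact ⟨connectedComponentIn_subset _ _ hJ, connectedComponentIn_eq hJ⟩
  · rintro ⟨hJ, rfl⟩
    refine ⟨mem_connectedComponentIn hJ, -o, ⟨?_, ?_⟩, J, by rwa [hmid], by rw [hmid]⟩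
    · intro h
      have h2 : (2 : ℝ) • o = 0 := by rw [two_smul]; nth_rewrite 2 [h]; exact add_neg_cancel o
      have h0 : o = 0 := by simpa using h2
      have h1 := hP.star_mul_self o ho
      rw [h0, mul_zero] at h1
      exact zero_ne_one h1
    · obtain ⟨s, hs, hs'⟩ := hsymm
      refine ⟨s, hs, hs' ?_⟩
      -- The point J is a midpoint, so some curve in P ends at -o; this puts -o in P.
      rw [← hmid] at hJ
      obtain ⟨γ, hγ, -⟩ := hJ
      rw [← hγ.1.2.2.2]
      exact hγ.1.2.1 1 ⟨zero_le_one, le_rfl⟩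

end HasExpGeodesics

end Geometry

end Centriole

/-! ### Unitary groups closed under exponentials, complex structures, and central pole involutions.
-/

namespace Centriole

section Structures

open Set intervalIntegral
open NormedSpace (exp)
open scoped RealInnerProductSpace

variable {M : Type*} [NormedRing M] [NormedAlgebra ℝ M] [StarRing M] {ι : Type*}

/-- `G` is a set of unitary elements closed under multiplication and `star` that contains the
exponentials of all skew elements. -/
structure IsExpClosed (G : Set M) : Prop where
  star_mul_self : ∀ a ∈ G, star a * a = 1
  mul_star_self : ∀ a ∈ G, a * star a = 1
  mul_mem : ∀ a ∈ G, ∀ b ∈ G, a * b ∈ G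
  star_mem : ∀ a ∈ G, star a ∈ G
  exp_mem : ∀ A : M, star A = -A → exp A ∈ G

/-- The complex structures in `G` which anticommute with all `y l`. -/
def complexStructures (G : Set M) (y : ι → M) : Set M :=
  {X | X ∈ G ∧ X * X = -1 ∧ ∀ l, X * y l = -(y l * X)}

section

variable [StarModule ℝ M]

variable (M) in
/-- The skew elements. -/
def skewElements : Submodule ℝ M where
  carrier := {w | star w = -w}
  add_mem' {v w} hv hw := by
    simp only [mem_ofPred_eq] at *
    rw [star_add, hv, hw, neg_add]
  zero_mem' := by simp
  smul_mem' r w hw := by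
    simp only [mem_ofPred_eq] at *
    rw [star_smul, hw, star_trivial, smul_neg]

/-- The skew elements which anticommute with `a` and commute with all `y l`. -/
def skewCommutant (y : ι → M) (a : M) : Submodule ℝ M where
  carrier := {w | star w = -w ∧ w * a = -(a * w) ∧ ∀ l, w * y l = y l * w}
  add_mem' {v w} hv hw := by
    refine ⟨(skewElements M).add_mem hv.1 hw.1, ?_, fun l => ?_⟩
    · rw [add_mul, mul_add, hv.2.1, hw.2.1, neg_add]
    · rw [add_mul, mul_add, hv.2.2, hw.2.2]
  zero_mem' := by simp
  smul_mem' r w hw := by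
    refine ⟨(skewElements M).smul_mem r hw.1, ?_, fun l => ?_⟩
    · rw [smul_mul_assoc, mul_smul_comm, hw.2.1, smul_neg]
    · rw [smul_mul_assoc, mul_smul_comm, hw.2.2]

theorem mem_skewCommutant {y : ι → M} {a w : M} :
    w ∈ skewCommutant y a ↔ star w = -w ∧ w * a = -(a * w) ∧ ∀ l, w * y l = y l * w := Iff.rfl

end

omit [NormedAlgebra ℝ M] in
theorem star_eq_neg_of_mul_self {X : M} (h : star X * X = 1) (h2 : X * X = -1) :
    star X = -X := by
  calc star X = -(star X * (X * X)) := by rw [h2, mul_neg_one, neg_neg]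
    _ = -X := by rw [← mul_assoc, h, one_mul]

variable {G : Set M}

omit [NormedAlgebra ℝ M] in
theorem IsExpClosed.star_eq_neg (hG : IsExpClosed G) {y : ι → M} {X : M}
    (hX : X ∈ complexStructures G y) : star X = -X :=
  star_eq_neg_of_mul_self (hG.star_mul_self X hX.1) hX.2.1

/-- A continuous path in `H` that starts in a component of `H` stays in it. -/
theorem mem_connectedComponentIn_of_path {E : Type*} [TopologicalSpace E] {H : Set E} {o : E}
    {c : ℝ → E} (hc : ContinuousOn c (Icc 0 1)) (hH : ∀ t ∈ Icc (0 : ℝ) 1, c t ∈ H)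
    (h0 : c 0 ∈ connectedComponentIn H o) :
    ∀ t ∈ Icc (0 : ℝ) 1, c t ∈ connectedComponentIn H o := by
  intro t ht
  rw [connectedComponentIn_eq h0]
  have hpre : IsPreconnected (c '' Icc 0 1) := isPreconnected_Icc.image c hc
  exact hpre.subset_connectedComponentIn ⟨0, ⟨le_rfl, zero_le_one⟩, rfl⟩
    (by rintro _ ⟨u, hu, rfl⟩; exact hH u hu) ⟨t, ht, rfl⟩

omit [StarRing M] in
-- The hypothesis gives 2‖D‖ = ‖D²‖ ≤ ‖D‖². With D = x - o this shows that fixed points of the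
-- symmetries are isolated at explicit distance 2.
theorem eq_zero_of_mul_self_eq {D o : M} (hn : ‖o * D‖ = ‖D‖)
    (h : D * D = -((2 : ℝ) • (o * D))) (h2 : ‖D‖ < 2) : D = 0 := by
  have e : ‖D * D‖ = 2 * ‖D‖ := by rw [h, norm_neg, norm_smul, hn]; simp
  have := norm_mul_le D D
  rw [e] at this
  by_contra hne
  have := norm_pos_iff.2 hne
  nlinarith

variable [TraceNorm M]

/-- A norm preserving linear involution of the ambient space which preserves `P` is a symmetry of
`P` at its fixed point `o` if it moves the other points of `P` near `o`. -/
theorem isGeodesicSymmetryAt_of_linearIsometry {P : Set M} {o : M} (s : M →ₗᵢ[ℝ] M) (ho : o ∈ P)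
    (hmaps : MapsTo s P P) (hinv : ∀ x ∈ P, s (s x) = x) (hfix : s o = o)
    (hiso : ∀ x ∈ P, ‖x - o‖ < 2 → s x = x → x = o) : IsGeodesicSymmetryAt P o s where
  smooth := s.contDiff
  mapsTo := hmaps
  involutive := hinv
  isometry c hc _ t _ := by
    have hd : HasDerivAt c (deriv c t) t := ((hc.differentiable one_ne_zero) t).hasDerivAt
    have h : HasDerivAt (s ∘ c) (s (deriv c t)) t :=
      s.toContinuousLinearMap.hasFDerivAt.comp_hasDerivAt t hd
    rw [h.deriv, s.norm_map]
  mem := ho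
  fixed := hfix
  isolated := by
    have : ∀ᶠ x in 𝓝[P] o, ‖x - o‖ < 2 := by
      refine nhdsWithin_le_nhds ?_
      filter_upwards [Metric.ball_mem_nhds o two_pos] with x hx
      rwa [Metric.mem_ball, dist_eq_norm] at hx
    filter_upwards [this, self_mem_nhdsWithin] with x hx hxP hsx
    exact hiso x hxP hx hsx

variable [StarModule ℝ M]

variable (M) in
/-- `star` as a linear isometry. -/
noncomputable def starIsometry : M →ₗᵢ[ℝ] M where
  toFun := star
  map_add' := star_add
  map_smul' r x := by simp [star_smul]
  norm_map' x := norm_star x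

omit [StarModule ℝ M] in
theorem norm_conj_neg {o : M} (ho : star o * o = 1) (ho' : o * star o = 1) (x : M) :
    ‖-(o * x * o)‖ = ‖x‖ := by
  rw [norm_neg, norm_mul_of_mul_star_self ho', norm_mul_of_star_mul_self ho]

/-- `x ↦ -(o * x * o)` as a linear isometry, for unitary `o`. -/
noncomputable def negConjIsometry (o : M) (ho : star o * o = 1) (ho' : o * star o = 1) :
    M →ₗᵢ[ℝ] M where
  toFun x := -(o * x * o)
  map_add' x y := by rw [mul_add, add_mul, neg_add]
  map_smul' r x := by simp
  norm_map' x := norm_conj_neg ho ho' x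

omit [StarModule ℝ M] in
/-- If the skew part of an element of the `(-1, 1)` block of an involution commutes with the
involution, it vanishes. -/
theorem eq_zero_of_sub_star_commute {z f : M} (hz : star z = z) (hzf : z * f = -f)
    (hfz : f * z = f) (h : (f - star f) * z = z * (f - star f)) : f = 0 := by
  have h1 : star f * z = -star f := by
    have := congr_arg star hzf
    rwa [star_mul, hz, star_neg] at this
  have h2 : z * star f = star f := by
    have := congr_arg star hfz
    rwa [star_mul, hz] at this
  have h3 : f = -star f := by
    rw [sub_mul, mul_sub, hfz, h1, hzf, h2, sub_neg_eq_add] at h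
    have : (2 : ℝ) • (f + star f) = 0 := by
      rw [two_smul]
      nth_rewrite 1 [h]
      abel
    exact eq_neg_of_add_eq_zero_left ((smul_eq_zero.1 this).resolve_left two_ne_zero)
  have h4 : f = -f := by
    rw [← hzf]
    nth_rewrite 2 [h3]
    rw [mul_neg, h2]
    exact h3
  have h5 : (2 : ℝ) • f = 0 := by
    rw [two_smul]
    nth_rewrite 2 [h4]
    exact add_neg_cancel f
  exact (smul_eq_zero.1 h5).resolve_left two_ne_zero

variable [CompleteSpace M]

omit [CompleteSpace M] in
theorem star_exp_conj_eq_neg {C B : M} (hC : star C = -C) (hB : star B = -B)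
    (t : ℝ) : star (exp (t • C) * B * exp (-(t • C))) = -(exp (t • C) * B * exp (-(t • C))) := by
  have h1 : star (exp (t • C)) = exp (-(t • C)) :=
    star_exp_of_skew (star_smul_of_skew hC t)
  have h2 : star (exp (-(t • C))) = exp (t • C) := by rw [← h1, star_star]
  rw [star_mul, star_mul, h1, h2, hB, neg_mul, mul_neg, mul_assoc]

omit [StarModule ℝ M] in
theorem star_eq_self_of_exp_mul_self {A : M} (hA : star A = -A) (h : exp A * exp A = 1) :
    star (exp A) = exp A := by
  rw [star_exp_of_skew hA]
  calc exp (-A) = exp (-A) * (exp A * exp A) := by rw [h, mul_one]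
    _ = exp A := by rw [← mul_assoc, exp_neg_mul_exp, one_mul]

omit [NormedAlgebra ℝ M] [StarRing M] [TraceNorm M] [StarModule ℝ M] [CompleteSpace M] in
/-- The `(-1, 1)` block of an involution in a prime algebra is nonzero, if it is not central. -/
theorem exists_block_ne_zero (hprime : ∀ a b : M, a ≠ 0 → b ≠ 0 → ∃ m, a * m * b ≠ 0) {z : M}
    (hz : z * z = 1) (h1 : z ≠ 1) (h2 : z ≠ -1) : ∃ f, f ≠ 0 ∧ z * f = -f ∧ f * z = f := by
  obtain ⟨m, hm⟩ := hprime (1 - z) (1 + z) (fun h => h1 (sub_eq_zero.1 h).symm)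
    (fun h => h2 (eq_neg_of_add_eq_zero_right h))
  refine ⟨_, hm, ?_, ?_⟩
  · rw [← mul_assoc, ← mul_assoc, mul_sub, hz, mul_one, ← neg_sub 1 z, neg_mul, neg_mul]
  · rw [mul_assoc _ (1 + z), add_mul, hz, one_mul, add_comm]

theorem IsExpClosed.hasExpGeodesics (hG : IsExpClosed G) :
    HasExpGeodesics G fun _ => skewElements M where
  star_mul_self := hG.star_mul_self
  skew _ _ _ hw := hw
  exp_mem a ha w hw := hG.mul_mem a ha _ (hG.exp_mem w hw)
  geodesic a ha b γ hγ := by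
    have hγd : ∀ t, HasDerivAt γ (deriv γ t) t := fun t =>
      ((hγ.1.1.differentiable one_ne_zero) t).hasDerivAt
    have hγG := hγ.1.2.1
    set B : ℝ → M := fun t => star (γ t) * deriv γ t with hB
    have hBs : ∀ t ∈ Icc (0 : ℝ) 1, star (B t) = -B t := fun t ht => by
      have := eqOn_deriv_of_eqOn_Icc zero_lt_one (fun t ht => hG.star_mul_self _ (hγG t ht)) ht
        ((hγd t).star.mul (hγd t)) (hasDerivAt_const t 1)
      simp only [hB, star_mul, star_star]
      exact eq_neg_of_add_eq_zero_left this
    -- Right multiplication by exp(φ C) keeps the curve in G, so the first variation applies in the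
    -- direction γ C.
    have hmom : ∀ C : M, star C = -C → ∀ t ∈ Icc (0 : ℝ) 1, ⟪B t, C⟫ = ⟪B 0, C⟫ := by
      intro C hC t ht
      have := hγ.inner_deriv_eq (Φ := fun t => γ t * C)
        (hγ.1.1.continuous.mul continuous_const) (fun φ hφ h0 h1 => by
          refine ⟨fun t => γ t * exp (φ t • C), ⟨hγ.1.1.mul ((contDiff_exp_smul C).comp hφ),
            fun t ht => hG.mul_mem _ (hγG t ht) _ (hG.exp_mem _ (star_smul_of_skew hC _)), ?_, ?_⟩,
            fun t _ => ?_⟩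
          · simp [h0, hγ.1.2.2.1]
          · simp [h1, hγ.1.2.2.2]
          · have hd : HasDerivAt (fun t => γ t * exp (φ t • C)) (deriv γ t * exp (φ t • C) +
                γ t * (deriv φ t • (exp (φ t • C) * C))) t :=
              (hγd t).mul (hasDerivAt_exp_smul_comp hφ C t)
            rw [hd.deriv]
            have hcomm : exp (φ t • C) * C = C * exp (φ t • C) :=
              (mul_exp_of_mul_eq (by simp)).symm
            rw [← norm_mul_of_mul_star_self (exp_mul_star_self (star_smul_of_skew hC (φ t)))
              (deriv γ t + _), hcomm, add_mul, smul_mul_assoc, mul_smul_comm, mul_assoc]) t ht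
      simpa only [hB, inner_eq_tr, star_mul, star_star, mul_assoc] using this
    have h01 : (0 : ℝ) ∈ Icc (0 : ℝ) 1 := ⟨le_rfl, zero_le_one⟩
    have hconst : ∀ t ∈ Icc (0 : ℝ) 1, B t = B 0 := by
      intro t ht
      -- Testing against the difference itself, which is an admissible direction, makes its norm
      -- vanish.
      have := hmom (B t - B 0) (by rw [star_sub, hBs t ht, hBs 0 h01]; abel) t ht
      rw [← sub_eq_zero, ← inner_sub_left, inner_self_eq_zero] at this
      exact sub_eq_zero.1 this
    refine ⟨B 0, hBs 0 h01, ?_⟩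
    rw [← hγ.1.2.2.1]
    refine eq_mul_exp_of_hasDerivAt fun t ht => ?_
    have : γ t * B 0 = deriv γ t := by
      rw [← hconst t ht]
      simp only [hB]
      rw [← mul_assoc, hG.mul_star_self _ (hγG t ht), one_mul]
    rw [this]
    exact hγd t

omit [CompleteSpace M] in
-- On G, `star` is inversion. It serves at 1 and at -1 alike, which makes them poles.
theorem IsExpClosed.isGeodesicSymmetryAt_star (hG : IsExpClosed G) {o : M} (ho : o ∈ G)
    (hos : star o = o) (hoc : ∀ x, x * o = o * x) :
    IsGeodesicSymmetryAt G o (starIsometry M) := by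
  refine isGeodesicSymmetryAt_of_linearIsometry _ ho (fun x hx => hG.star_mem x hx)
    (fun x _ => star_star x) hos fun x hx hn hsx => ?_
  change star x = x at hsx
  have hsq : ∀ x ∈ G, star x = x → x * x = 1 := fun x hx h => by
    nth_rewrite 1 [← h]
    exact hG.star_mul_self x hx
  refine sub_eq_zero.1 (eq_zero_of_mul_self_eq (o := o)
    (norm_mul_of_star_mul_self (hG.star_mul_self o ho) _) ?_ hn)
  rw [sub_mul, mul_sub, mul_sub, hsq x hx hsx, hsq o ho hos, hoc, two_smul]
  abel

/-- Otherwise the involution exp A has a nonzero (-1, 1) block f. The skew element f - f* preserves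
skewness under conjugation, so it commutes with exp A, which forces f = 0. -/
theorem exp_eq_neg_one_of_forall_commute
    (hprime : ∀ a b : M, a ≠ 0 → b ≠ 0 → ∃ m, a * m * b ≠ 0) {A : M} (hA : star A = -A)
    (hAA : exp A * exp A = 1) (hA1 : exp A ≠ 1)
    (hC : ∀ C : M, (∀ t : ℝ, ∀ B ∈ skewElements M,
      exp (t • C) * B * exp (-(t • C)) ∈ skewElements M) → C * exp A = exp A * C) :
    exp A = -1 := by
  by_contra hne
  obtain ⟨f, hf, hzf, hfz⟩ := exists_block_ne_zero hprime hAA hA1 hne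
  refine hf (eq_zero_of_sub_star_commute (star_eq_self_of_exp_mul_self hA hAA) hzf hfz
    (hC _ fun t B hB => star_exp_conj_eq_neg ?_ hB t))
  rw [star_sub, star_star, neg_sub]

theorem exp_conj_mem_skewCommutant {y : ι → M} {o C B : M} (hC : star C = -C)
    (hCo : C * o = o * C) (hCy : ∀ l, C * y l = y l * C) (hB : B ∈ skewCommutant y o) (t : ℝ) :
    exp (t • C) * B * exp (-(t • C)) ∈ skewCommutant y o := by
  have key : ∀ x : M, C * x = x * C → ∀ t : ℝ, exp (t • C) * x = x * exp (t • C) := fun x hx t =>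
    (mul_exp_of_mul_eq (by rw [mul_smul_comm, smul_mul_assoc, hx])).symm
  have key' : ∀ x : M, C * x = x * C → ∀ t : ℝ, exp (-(t • C)) * x = x * exp (-(t • C)) :=
    fun x hx t => by rw [← neg_smul]; exact key x hx (-t)
  refine ⟨star_exp_conj_eq_neg hC hB.1 t, ?_, fun l => ?_⟩
  · rw [mul_assoc, key' o hCo, mul_assoc, ← mul_assoc B, hB.2.1, ← mul_assoc o, ← mul_assoc o,
      ← key o hCo, neg_mul, mul_neg]
    simp only [mul_assoc]
  · rw [mul_assoc, key' _ (hCy l), mul_assoc, ← mul_assoc B, hB.2.2, ← mul_assoc (y l),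
      ← mul_assoc (y l), ← key _ (hCy l)]
    simp only [mul_assoc]

/-- Here f - f* preserves the tangent space only if it commutes with o and all y l. The block f is
therefore first corrected, using A and A * y l * o to flip the sign with respect to o and to y l
respectively. -/
theorem exp_eq_neg_one_of_forall_commute_skewCommutant [Finite ι]
    (hprime : ∀ a b : M, a ≠ 0 → b ≠ 0 → ∃ m, a * m * b ≠ 0) {y : ι → M} {o : M}
    (hos : star o = -o) (hoo : o * o = -1) (hoy : ∀ l, o * y l = -(y l * o))
    (hys : ∀ l, star (y l) = -y l) (hyy : ∀ l, y l * y l = -1)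
    (hy : ∀ l l', l ≠ l' → y l * y l' = -(y l' * y l)) {A : M} (hA : A ∈ skewCommutant y o)
    (hAA : exp A * exp A = 1) (hA1 : exp A ≠ 1)
    (hC : ∀ C : M, (∀ t : ℝ, ∀ B ∈ skewCommutant y o,
      exp (t • C) * B * exp (-(t • C)) ∈ skewCommutant y o) → C * exp A = exp A * C) :
    exp A = -1 := by
  classical
  have := Fintype.ofFinite ι
  by_contra hne
  obtain ⟨hAs, hAo, hAy⟩ := mem_skewCommutant.1 hA
  set z := exp A with hz
  have hzs : star z = z := star_eq_self_of_exp_mul_self hAs hAA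
  have hyz : ∀ l, y l * z = z * y l := fun l => mul_exp_of_mul_eq (hAy l).symm
  have hoz : o * z = z * o := by
    have h1 : o * z = exp (-A) * o := mul_exp_of_mul_eq (by rw [neg_mul, hAo, neg_neg])
    rw [h1, ← star_exp_of_skew hAs, ← hz, hzs]
  have hAz : A * z = z * A := mul_exp_of_mul_eq rfl
  -- A vector killed by A is fixed by z = exp A, so A is injective on the -1 eigenspace of z.
  have hinj : ∀ g, z * g = -g → A * g = 0 → g = 0 := fun g h1 h2 => by
    have h3 := exp_mul_eq_self_of_mul_eq_zero h2
    rw [← hz, h1] at h3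
    have h4 : (2 : ℝ) • g = 0 := by
      rw [two_smul]
      nth_rewrite 1 [← h3]
      exact neg_add_cancel g
    exact (smul_eq_zero.1 h4).resolve_left two_ne_zero
  obtain ⟨f, hf, hzf, hfz⟩ := exists_block_ne_zero hprime hAA hA1 hne
  -- The anticommuting family is o (index `none`) together with the y l.
  obtain ⟨g, hg, hzg, hgz, hgy⟩ := exists_commute_of_signFlip
    (y := fun i : Option ι => i.elim o y)
    (N := fun i : Option ι => i.elim A fun l => A * y l * o) (z := z)
    (by rintro (_ | l) <;> simp [hoo, hyy])
    (by
      rintro (_ | l) (_ | l') h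
      · exact absurd rfl h
      · exact hoy l'
      · simp [hoy l]
      · exact hy l l' fun e => h (e ▸ rfl))
    (by rintro (_ | l) <;> simp [hoz, hyz])
    (by
      rintro (_ | l)
      · exact hAz
      · simp only [Option.elim_some]
        rw [mul_assoc, hoz, ← mul_assoc, mul_assoc A, hyz, ← mul_assoc, hAz]
        simp only [mul_assoc])
    (by
      rintro (_ | l)
      · exact hAo
      · simp only [Option.elim_some]
        rw [mul_assoc, hoy, mul_neg, ← mul_assoc, mul_assoc A, ← mul_assoc (y l), ← mul_assoc (y l),
          ← hAy, ← mul_assoc])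
    (by
      rintro (_ | l) (_ | l') h
      · exact absurd rfl h
      · exact hAy l'
      · simp only [Option.elim_some, Option.elim_none]
        rw [← mul_assoc, ← mul_assoc, ← neg_eq_iff_eq_neg.2 hAo, neg_mul, neg_mul, mul_assoc A o,
          hoy, mul_neg, neg_mul, neg_neg, ← mul_assoc A]
      · have hll : l ≠ l' := fun e => h (e ▸ rfl)
        simp only [Option.elim_some]
        rw [mul_assoc, hoy, mul_neg, ← mul_assoc, mul_assoc A, hy l l' hll, mul_neg, neg_mul,
          neg_neg, ← mul_assoc, hAy]
        simp only [mul_assoc])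
    (by
      rintro (_ | l) g h1 h2
      · exact hinj g h1 h2
      · simp only [Option.elim_some] at h2
        have h3 : y l * (o * g) = 0 := hinj _ (by
          rw [← mul_assoc, ← mul_assoc, ← hyz, mul_assoc (y l), ← hoz, mul_assoc, mul_assoc o, h1,
            mul_neg, mul_neg]) (by simpa only [mul_assoc] using h2)
        have h4 : o * (y l * (y l * (o * g))) = 0 := by rw [h3, mul_zero, mul_zero]
        rwa [← mul_assoc (y l), hyy, neg_one_mul, mul_neg, ← mul_assoc, hoo, neg_one_mul,
          neg_neg] at h4)
    hf hzf hfz Finset.univ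
  have hgo : o * g = g * o := hgy none (Finset.mem_univ _)
  have hgy' : ∀ l, y l * g = g * y l := fun l => hgy (some l) (Finset.mem_univ _)
  have hstar : ∀ x : M, star x = -x → x * g = g * x → (g - star g) * x = x * (g - star g) := by
    intro x hx h
    have := congr_arg star h
    rw [star_mul, star_mul, hx, mul_neg, neg_mul, neg_inj] at this
    rw [sub_mul, mul_sub, h, this]
  refine hg (eq_zero_of_sub_star_commute hzs hzg hgz (hC _ fun t B hB =>
    exp_conj_mem_skewCommutant ?_ (hstar o hos hgo) (fun l => hstar _ (hys l) (hgy' l)) hB t))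
  rw [star_sub, star_star, neg_sub]

end Structures

end Centriole

/-! ### Components of complex structures, and their minimal centrioles. -/

namespace Centriole

section Components

open Set intervalIntegral
open NormedSpace (exp)
open scoped RealInnerProductSpace

variable {M : Type*} [NormedRing M] [NormedAlgebra ℝ M] [StarRing M] [TraceNorm M]
  [StarModule ℝ M] [CompleteSpace M] {ι : Type*} {G : Set M} {y : ι → M}

omit [TraceNorm M] in
theorem IsExpClosed.mul_exp_mem_complexStructures (hG : IsExpClosed G) {a w : M}
    (ha : a ∈ complexStructures G y) (hw : w ∈ skewCommutant y a) :
    a * exp w ∈ complexStructures G y := by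
  obtain ⟨haG, haa, hay⟩ := ha
  obtain ⟨hws, hwa, hwy⟩ := mem_skewCommutant.1 hw
  refine ⟨hG.mul_mem a haG _ (hG.exp_mem w hws), ?_, fun l => ?_⟩
  · have h : a * exp w = exp (-w) * a := mul_exp_of_mul_eq (by rw [neg_mul, hwa, neg_neg])
    calc a * exp w * (a * exp w) = a * (exp w * exp (-w)) * a := by
          nth_rewrite 2 [h]; simp only [mul_assoc]
      _ = -1 := by rw [exp_mul_exp_neg, mul_one, haa]
  · have h : y l * exp w = exp w * y l := mul_exp_of_mul_eq (hwy l).symm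
    rw [mul_assoc, ← h, ← mul_assoc, hay, neg_mul, mul_assoc]

/-- Conjugation by exp(φ C), with C skew and commuting with the y l, varies curves inside the
component. The resulting first variation shows that B = γ γ' is constant, and γ² = -1 turns this
into γ' = γ (-B). -/
theorem IsExpClosed.hasExpGeodesics_component (hG : IsExpClosed G) (o : M) :
    HasExpGeodesics (connectedComponentIn (complexStructures G y) o) (skewCommutant y) where
  star_mul_self a ha := hG.star_mul_self a (connectedComponentIn_subset _ _ ha).1
  skew _ _ _ hw := hw.1
  exp_mem a ha w hw := by
    have := mem_connectedComponentIn_of_path (c := fun t : ℝ => a * exp (t • w))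
      (contDiff_mul_exp_smul a w).continuous.continuousOn
      (fun t _ => hG.mul_exp_mem_complexStructures (connectedComponentIn_subset _ _ ha)
        ((skewCommutant y a).smul_mem t hw)) (by simpa using ha) 1 ⟨zero_le_one, le_rfl⟩
    simpa using this
  geodesic a ha b γ hγ := by
    have hγd : ∀ t, HasDerivAt γ (deriv γ t) t := fun t =>
      ((hγ.1.1.differentiable one_ne_zero) t).hasDerivAt
    have hγP := hγ.1.2.1
    have hγH : ∀ t ∈ Icc (0 : ℝ) 1, γ t ∈ complexStructures G y := fun t ht =>
      connectedComponentIn_subset _ _ (hγP t ht)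
    have h01 : (0 : ℝ) ∈ Icc (0 : ℝ) 1 := ⟨le_rfl, zero_le_one⟩
    set B : ℝ → M := fun t => γ t * deriv γ t with hB
    have hd1 : ∀ t ∈ Icc (0 : ℝ) 1, star (deriv γ t) = -deriv γ t := fun t ht =>
      eqOn_deriv_of_eqOn_Icc zero_lt_one (fun t ht => hG.star_eq_neg (hγH t ht)) ht
        (hγd t).star (hγd t).neg
    have hd2 : ∀ t ∈ Icc (0 : ℝ) 1, deriv γ t * γ t = -(γ t * deriv γ t) := fun t ht =>
      eq_neg_of_add_eq_zero_left (eqOn_deriv_of_eqOn_Icc zero_lt_one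
        (fun t ht => (hγH t ht).2.1) ht ((hγd t).mul (hγd t)) (hasDerivAt_const t (-1)))
    have hd3 : ∀ t ∈ Icc (0 : ℝ) 1, ∀ l, deriv γ t * y l = -(y l * deriv γ t) := fun t ht l =>
      eqOn_deriv_of_eqOn_Icc zero_lt_one (fun t ht => (hγH t ht).2.2 l) ht
        ((hγd t).mul_const (y l)) ((hγd t).const_mul (y l)).neg
    have hBs : ∀ t ∈ Icc (0 : ℝ) 1, star (B t) = -B t := fun t ht => by
      simp only [hB]
      rw [star_mul, hd1 t ht, hG.star_eq_neg (hγH t ht), neg_mul_neg, hd2 t ht]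
    have hBy : ∀ t ∈ Icc (0 : ℝ) 1, ∀ l, B t * y l = y l * B t := fun t ht l => by
      simp only [hB]
      rw [mul_assoc, hd3 t ht, mul_neg, ← mul_assoc, (hγH t ht).2.2, neg_mul, neg_neg, mul_assoc]
    have hmom : ∀ C : M, star C = -C → (∀ l, C * y l = y l * C) →
        ∀ t ∈ Icc (0 : ℝ) 1, ⟪B t, C⟫ = ⟪B 0, C⟫ := by
      intro C hC hCy
      have hCs : ∀ r : ℝ, star (-(r • C)) = - -(r • C) := fun r => by
        rw [star_neg, star_smul_of_skew hC]
      have hcomm : ∀ r : ℝ, ∀ x : M, C * x = x * C → x * exp (r • C) = exp (r • C) * x :=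
        fun r x hx => mul_exp_of_mul_eq (by rw [mul_smul_comm, smul_mul_assoc, hx])
      have hcomm' : ∀ r : ℝ, ∀ x : M, C * x = x * C → x * exp (-(r • C)) = exp (-(r • C)) * x :=
        fun r x hx => by rw [← neg_smul]; exact hcomm _ x hx
      have hvar := hγ.inner_deriv_eq (Φ := fun t => C * γ t - γ t * C)
        ((continuous_const.mul hγ.1.1.continuous).sub (hγ.1.1.continuous.mul continuous_const))
        (fun φ hφ h0 h1 => by
          have hneg : ContDiff ℝ 1 fun t => exp (-(φ t • C)) := by
            simp_rw [← smul_neg]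
            exact (contDiff_exp_smul (-C)).comp hφ
          have hcC : ContDiff ℝ 1 fun t => exp (φ t • C) * γ t * exp (-(φ t • C)) :=
            (((contDiff_exp_smul C).comp hφ).mul hγ.1.1).mul hneg
          refine ⟨fun t => exp (φ t • C) * γ t * exp (-(φ t • C)), ⟨hcC,
            mem_connectedComponentIn_of_path hcC.continuous.continuousOn (fun t ht => ?_) ?_,
            ?_, ?_⟩, fun t _ => ?_⟩
          · obtain ⟨h1, h2, h3⟩ := hγH t ht
            refine ⟨hG.mul_mem _ (hG.mul_mem _ (hG.exp_mem _ (star_smul_of_skew hC _)) _ h1) _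
              (hG.exp_mem _ (hCs _)), ?_, fun l => ?_⟩
            · calc exp (φ t • C) * γ t * exp (-(φ t • C)) *
                    (exp (φ t • C) * γ t * exp (-(φ t • C)))
                  = exp (φ t • C) * (γ t * (exp (-(φ t • C)) * exp (φ t • C)) * γ t) *
                    exp (-(φ t • C)) := by simp only [mul_assoc]
                _ = -1 := by
                  rw [exp_neg_mul_exp, mul_one, h2, mul_neg_one, neg_mul, exp_mul_exp_neg]
            · rw [mul_assoc, ← hcomm' _ _ (hCy l), ← mul_assoc, mul_assoc _ (γ t), h3, mul_neg,
                ← mul_assoc, ← hcomm _ _ (hCy l), neg_mul]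
              simp only [mul_assoc]
          · simpa [h0, hγ.1.2.2.1] using ha
          · simp [h0, hγ.1.2.2.1]
          · simp [h1, hγ.1.2.2.2]
          · have e1 := hasDerivAt_exp_smul_comp hφ C t
            have e2 := hasDerivAt_exp_smul_comp hφ (-C) t
            simp only [smul_neg] at e2
            have hd : HasDerivAt (fun t => exp (φ t • C) * γ t * exp (-(φ t • C)))
                ((deriv φ t • (exp (φ t • C) * C) * γ t + exp (φ t • C) * deriv γ t) *
                  exp (-(φ t • C)) + exp (φ t • C) * γ t *
                  (deriv φ t • (exp (-(φ t • C)) * -C))) t :=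
              (e1.mul (hγd t)).mul e2
            rw [hd.deriv, ← norm_mul_of_star_mul_self
              (star_exp_mul_self (star_smul_of_skew hC (φ t))) (deriv γ t + _),
              ← norm_mul_of_mul_star_self (exp_mul_star_self (hCs (φ t))) (exp (φ t • C) * _),
              mul_neg, ← hcomm' _ _ rfl]
            congr 1
            simp only [mul_add, add_mul, mul_sub, sub_mul, mul_smul_comm, smul_mul_assoc, smul_sub,
              mul_neg, smul_neg, mul_assoc]
            abel)
      -- The two commutator terms contribute equally, because γ anticommutes with γ' and the trace
      -- is cyclic.
      have hexp : ∀ t ∈ Icc (0 : ℝ) 1, ⟪deriv γ t, C * γ t - γ t * C⟫ = 2 * ⟪B t, C⟫ := by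
        intro t ht
        rw [inner_eq_tr, inner_eq_tr, hBs t ht, hd1 t ht, mul_sub, map_sub, ← mul_assoc,
          TraceNorm.tr_mul_comm _ (γ t), ← mul_assoc, ← mul_assoc]
        simp only [hB]
        rw [neg_mul, neg_mul, hd2 t ht, mul_neg]
        simp only [neg_mul, map_neg, neg_neg]
        ring
      intro t ht
      have := hvar t ht
      rw [hexp t ht, hexp 0 h01] at this
      linarith
    have hconst : ∀ t ∈ Icc (0 : ℝ) 1, B t = B 0 := by
      intro t ht
      have := hmom (B t - B 0) (by rw [star_sub, hBs t ht, hBs 0 h01]; abel)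
        (fun l => by rw [sub_mul, mul_sub, hBy t ht, hBy 0 h01]) t ht
      rw [← sub_eq_zero, ← inner_sub_left, inner_self_eq_zero] at this
      exact sub_eq_zero.1 this
    have hB0 : B 0 ∈ skewCommutant y a := by
      refine ⟨hBs 0 h01, ?_, hBy 0 h01⟩
      rw [← hγ.1.2.2.1]
      simp only [hB]
      rw [mul_assoc, hd2 0 h01, mul_neg]
    refine ⟨-B 0, (skewCommutant y a).neg_mem hB0, ?_⟩
    rw [← hγ.1.2.2.1]
    refine eq_mul_exp_of_hasDerivAt fun t ht => ?_
    have : γ t * -B 0 = deriv γ t := by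
      rw [← hconst t ht]
      simp only [hB]
      rw [mul_neg, ← mul_assoc, (hγH t ht).2.1, neg_one_mul, neg_neg]
    rw [this]
    exact hγd t

omit [StarModule ℝ M] [CompleteSpace M] in
-- As o⁻¹ = -o, the map is conjugation by o; its fixed points commute with o. The points o and -o
-- give the same map, hence are poles when both lie in the component.
theorem IsExpClosed.isGeodesicSymmetryAt_component (hG : IsExpClosed G) {o : M}
    (ho : o ∈ complexStructures G y) :
    IsGeodesicSymmetryAt (connectedComponentIn (complexStructures G y) o) o
      (fun x => -(o * x * o)) := by
  have hou := hG.star_mul_self o ho.1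
  have hou' := hG.mul_star_self o ho.1
  have hos := hG.star_eq_neg ho
  have hfix : -(o * o * o) = o := by rw [ho.2.1, neg_one_mul, neg_neg]
  refine isGeodesicSymmetryAt_of_linearIsometry (negConjIsometry o hou hou')
    (mem_connectedComponentIn ho) ?_ (fun x _ => ?_) hfix fun x hx hn hsx => ?_
  · have hmaps : MapsTo (negConjIsometry o hou hou') (complexStructures G y)
        (complexStructures G y) := by
      rintro x ⟨h1, h2, h3⟩
      change -(o * x * o) ∈ _
      refine ⟨?_, ?_, fun l => ?_⟩
      · rw [← mul_neg, ← hos]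
        exact hG.mul_mem _ (hG.mul_mem o ho.1 x h1) _ (hG.star_mem o ho.1)
      · calc -(o * x * o) * -(o * x * o) = o * (x * (o * o) * x) * o := by
              rw [neg_mul_neg]; simp only [mul_assoc]
          _ = -1 := by rw [ho.2.1, mul_neg_one, neg_mul, h2, neg_neg, mul_one, ho.2.1]
      · rw [neg_mul, mul_assoc, ho.2.2, mul_neg, ← mul_assoc, mul_assoc o, h3, mul_neg,
          ← mul_assoc, ho.2.2]
        simp only [neg_mul, mul_neg, neg_neg, mul_assoc]
    have hm := (negConjIsometry o hou hou').continuous.continuousOn.mapsTo_connectedComponentIn ho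
    change MapsTo _ _ (connectedComponentIn _ (-(o * o * o))) at hm
    rw [hfix] at hm
    exact hm.mono_right (connectedComponentIn_mono o hmaps.image_subset)
  · change -(o * -(o * x * o) * o) = x
    calc -(o * -(o * x * o) * o) = o * o * x * (o * o) := by
          rw [mul_neg, neg_mul, neg_neg]; simp only [mul_assoc]
      _ = x := by rw [ho.2.1, neg_one_mul, neg_mul_neg, mul_one]
  · change -(o * x * o) = x at hsx
    have hxx := (connectedComponentIn_subset _ _ hx).2.1
    have hc : x * o = o * x := by
      calc x * o = -(o * x * o) * o := by rw [hsx]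
        _ = o * x := by rw [neg_mul, mul_assoc _ o o, ho.2.1, mul_neg_one, neg_neg]
    refine sub_eq_zero.1 (eq_zero_of_mul_self_eq (o := o) (norm_mul_of_star_mul_self hou _) ?_ hn)
    rw [sub_mul, mul_sub, mul_sub, hxx, ho.2.1, hc, two_smul]
    abel

/-- The minimal centrioles of `G` for the base point `1`. -/
theorem IsExpClosed.minimalCentriole_iff [Nontrivial M] (hG : IsExpClosed G)
    (hprime : ∀ a b : M, a ≠ 0 → b ≠ 0 → ∃ m, a * m * b ≠ 0) {J : M} {C : Set M} :
    (J ∈ C ∧ ∃ q, (AreSymmetryPoles G 1 q ∧ ∃ m ∈ geodesicMidpoints G 1 q,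
      C = connectedComponentIn (geodesicMidpoints G 1 q) m)) ↔
    J ∈ {X | X ∈ G ∧ X * X = -1} ∧ C = connectedComponentIn {X | X ∈ G ∧ X * X = -1} J := by
  have h1 : (1 : M) ∈ G := by simpa using hG.exp_mem 0 (by simp)
  refine hG.hasExpGeodesics.exists_component_geodesicMidpoints_iff h1 ?_ ?_ ?_ ?_
  · ext X
    constructor
    · rintro ⟨hX, hXX⟩
      exact ⟨X, star_eq_neg_of_mul_self (hG.star_mul_self X hX) hXX, hXX, (one_mul X).symm⟩
    · rintro ⟨w, hw, hww, rfl⟩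
      rw [one_mul]
      refine ⟨?_, hww⟩
      have := hG.exp_mem _ (star_smul_of_skew hw (Real.pi / 2))
      rw [exp_smul_of_mul_self_eq_neg_one hww (by positivity)] at this
      simpa using this
  · intro A hA hA1
    refine star_eq_neg_of_mul_self (star_exp_mul_self (star_smul_of_skew hA _)) ?_
    rw [← exp_add_smul, add_halves, one_smul, hA1]
  · exact fun A hA hAA hA1 hC => exp_eq_neg_one_of_forall_commute hprime hA hAA hA1 hC
  · exact ⟨_, hG.isGeodesicSymmetryAt_star h1 (star_one M) (fun x => by simp), fun h =>
      hG.isGeodesicSymmetryAt_star h (by simp) (fun x => by simp)⟩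

/-- The minimal centrioles of a component of `complexStructures G y`. -/
theorem IsExpClosed.minimalCentriole_component_iff [Nontrivial M] [Finite ι] (hG : IsExpClosed G)
    (hprime : ∀ a b : M, a ≠ 0 → b ≠ 0 → ∃ m, a * m * b ≠ 0) {o : M}
    (ho : o ∈ complexStructures G y) (hys : ∀ l, star (y l) = -y l)
    (hyy : ∀ l, y l * y l = -1) (hy : ∀ l l', l ≠ l' → y l * y l' = -(y l' * y l))
    {P N : Set M} (hP : P = connectedComponentIn (complexStructures G y) o)
    (hN : N = {X | X ∈ complexStructures G y ∧ X * o = -(o * X)}) {J : M} {C : Set M} :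
    (J ∈ C ∧ ∃ q, (AreSymmetryPoles P o q ∧ ∃ m ∈ geodesicMidpoints P o q,
      C = connectedComponentIn (geodesicMidpoints P o q) m)) ↔
    J ∈ N ∧ C = connectedComponentIn N J := by
  have hos := hG.star_eq_neg ho
  have hoP : o ∈ P := hP ▸ mem_connectedComponentIn ho
  have hPg : HasExpGeodesics P (skewCommutant y) := hP ▸ hG.hasExpGeodesics_component o
  refine hPg.exists_component_geodesicMidpoints_iff hoP ?_ ?_ ?_ ?_
  · rw [hN]
    ext X
    constructor
    · rintro ⟨hX, hXo⟩
      have hXs := hG.star_eq_neg hX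
      refine ⟨-(o * X), ⟨?_, ?_, fun l => ?_⟩, ?_, ?_⟩
      · rw [star_neg, star_mul, hXs, hos, neg_mul_neg, hXo]
      · rw [neg_mul, mul_assoc, hXo]
      · rw [neg_mul, mul_assoc, hX.2.2, mul_neg, ← mul_assoc, ho.2.2]
        simp only [neg_mul, mul_neg, neg_neg, mul_assoc]
      · calc -(o * X) * -(o * X) = o * (X * o) * X := by
              rw [neg_mul_neg]; simp only [mul_assoc]
          _ = -(o * o * (X * X)) := by rw [hXo]; simp only [neg_mul, mul_neg, mul_assoc]
          _ = -1 := by rw [ho.2.1, hX.2.1, neg_mul_neg, mul_one]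
      · rw [mul_neg, ← mul_assoc, ho.2.1, neg_one_mul, neg_neg]
    · rintro ⟨w, hw, hww, rfl⟩
      -- The point o * w equals o * exp((π/2) w), so it already lies in P.
      have hmem := hPg.exp_mem o hoP _ ((skewCommutant y o).smul_mem (Real.pi / 2) hw)
      rw [exp_smul_of_mul_self_eq_neg_one hww (by positivity)] at hmem
      simp only [Real.cos_pi_div_two, Real.sin_pi_div_two, zero_smul, one_smul, zero_add] at hmem
      rw [hP] at hmem
      refine ⟨connectedComponentIn_subset _ _ hmem, ?_⟩
      rw [mul_assoc, hw.2.1, mul_neg]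
  · intro A hA hA1
    have hsq : exp ((1 / 2 : ℝ) • A) * exp ((1 / 2 : ℝ) • A) = -1 := by
      rw [← exp_add_smul, add_halves, one_smul, hA1]
    have hs : star (exp ((1 / 2 : ℝ) • A)) = -exp ((1 / 2 : ℝ) • A) :=
      star_eq_neg_of_mul_self (star_exp_mul_self (star_smul_of_skew hA.1 _)) hsq
    refine ⟨hs, ?_, fun l => ?_⟩
    -- Passing o across exp(A/2) inverts it, and its inverse is its star, which is its negative.
    · have h1 : o * exp ((1 / 2 : ℝ) • A) = exp (-((1 / 2 : ℝ) • A)) * o :=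
        mul_exp_of_mul_eq (by
          rw [mul_smul_comm, neg_mul, smul_mul_assoc, hA.2.1, smul_neg, neg_neg])
      rw [h1, ← star_exp_of_skew (star_smul_of_skew hA.1 _), hs, neg_mul, neg_neg]
    · exact (mul_exp_of_mul_eq (by rw [mul_smul_comm, smul_mul_assoc, hA.2.2])).symm
  · exact fun A hA hAA hA1 hC => exp_eq_neg_one_of_forall_commute_skewCommutant hprime hos ho.2.1
      ho.2.2 hys hyy hy hA hAA hA1 hC
  · refine ⟨_, hP ▸ hG.isGeodesicSymmetryAt_component ho, fun h => ?_⟩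
    rw [hP] at h
    have := hG.isGeodesicSymmetryAt_component (connectedComponentIn_subset _ _ h)
    rw [← connectedComponentIn_eq h, ← hP] at this
    simpa only [neg_mul, mul_neg, neg_neg] using this

end Components

end Centriole

/-! ### Matrices with the Frobenius norm as a prime normed algebra with trace. -/

namespace Centriole

section FrobeniusAlgebra

variable {𝕂 : Type*} [NormedRing 𝕂] {n : Type*} [Fintype n]

theorem frobenius_norm_sq (A : Matrix n n 𝕂) : ‖A‖ ^ 2 = ∑ i, ∑ j, ‖A i j‖ ^ 2 := by
  rw [Matrix.frobenius_norm_def, ← Real.sqrt_eq_rpow, Real.sq_sqrt (by positivity)]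
  simp

theorem frobenius_norm_mul_le (A B : Matrix n n 𝕂) : ‖A * B‖ ≤ ‖A‖ * ‖B‖ := by
  refine (pow_le_pow_iff_left₀ (norm_nonneg _) (by positivity) two_ne_zero).1 ?_
  rw [mul_pow, frobenius_norm_sq, frobenius_norm_sq, frobenius_norm_sq, Finset.sum_mul]
  refine Finset.sum_le_sum fun i _ => ?_
  rw [Finset.sum_comm, Finset.mul_sum]
  refine Finset.sum_le_sum fun j _ => ?_
  calc ‖(A * B) i j‖ ^ 2 ≤ (∑ l, ‖A i l‖ * ‖B l j‖) ^ 2 := by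
        gcongr
        rw [Matrix.mul_apply]
        exact (norm_sum_le _ _).trans (Finset.sum_le_sum fun l _ => norm_mul_le _ _)
    _ ≤ _ := Finset.sum_mul_sq_le_sq_mul_sq _ _ _

variable [DecidableEq n]

/-- The Frobenius norm makes the matrices over a normed ring a normed ring. -/
noncomputable instance matrixNormedRing : NormedRing (Matrix n n 𝕂) :=
  { Matrix.frobeniusNormedAddCommGroup, Matrix.instRing with
    norm_mul_le := frobenius_norm_mul_le }

/-- A matrix unit between a nonzero entry of a and a nonzero entry of b produces their product as an
entry. This is the primeness behind the nonzero block of a noncentral involution. -/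
theorem exists_mul_mul_ne_zero [NoZeroDivisors 𝕂] {a b : Matrix n n 𝕂} (ha : a ≠ 0)
    (hb : b ≠ 0) : ∃ m, a * m * b ≠ 0 := by
  have : Nontrivial 𝕂 := by
    by_contra h
    rw [not_nontrivial_iff_subsingleton] at h
    exact ha (Subsingleton.elim _ _)
  obtain ⟨i, j, hij⟩ : ∃ i j, a i j ≠ 0 := by
    by_contra! h; exact ha (Matrix.ext h)
  obtain ⟨k, l, hkl⟩ : ∃ i j, b i j ≠ 0 := by
    by_contra! h; exact hb (Matrix.ext h)
  refine ⟨Matrix.single j k 1, fun h => ?_⟩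
  have := congr_fun (congr_fun h i) l
  rw [Matrix.mul_assoc, Matrix.mul_apply, Finset.sum_eq_single j] at this
  · simp [hij, hkl] at this
  · intro c _ hc
    simp [Matrix.single_mul_apply_of_ne, hc]
  · simp

variable [NormedAlgebra ℝ 𝕂]

/-- The Frobenius norm makes the matrices over a normed algebra a normed algebra. -/
noncomputable instance matrixNormedAlgebra : NormedAlgebra ℝ (Matrix n n 𝕂) :=
  { Matrix.frobeniusNormedSpace, Matrix.instAlgebra with }

instance [FiniteDimensional ℝ 𝕂] : CompleteSpace (Matrix n n 𝕂) :=
  FiniteDimensional.complete ℝ _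

variable [StarRing 𝕂] [TraceNorm 𝕂]

/-- The composition of the matrix trace with a trace of the coefficients. -/
noncomputable instance matrixTraceNorm : TraceNorm (Matrix n n 𝕂) where
  tr := TraceNorm.tr ∘ₗ Matrix.traceLinearMap n ℝ 𝕂
  tr_mul_comm x y := by
    simp only [LinearMap.comp_apply, Matrix.traceLinearMap_apply, Matrix.trace, Matrix.diag,
      Matrix.mul_apply, map_sum]
    rw [Finset.sum_comm]
    simp_rw [TraceNorm.tr_mul_comm (x _ _)]
  tr_star x := by
    simp only [LinearMap.comp_apply, Matrix.traceLinearMap_apply, Matrix.trace, Matrix.diag,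
      Matrix.star_apply, map_sum, TraceNorm.tr_star]
  norm_sq_eq x := by
    rw [frobenius_norm_sq, Finset.sum_comm]
    simp only [LinearMap.comp_apply, Matrix.traceLinearMap_apply, Matrix.trace, Matrix.diag,
      Matrix.mul_apply, Matrix.star_apply, map_sum, TraceNorm.norm_sq_eq]

end FrobeniusAlgebra

/-! ### Removing the factor 1/√p from speeds and lengths. -/

section Transfer

open Set intervalIntegral

variable {𝕂 : Type*} [NormedRing 𝕂] [NormedAlgebra ℝ 𝕂] {p : ℕ}

theorem speed_eq_speed_iff (hp : 0 < p) (c d : ℝ → Matrix (Fin p) (Fin p) 𝕂) (s t : ℝ) :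
    speed c s = speed d t ↔ ‖deriv c s‖ = ‖deriv d t‖ :=
  div_left_inj' (Real.sqrt_pos.2 (Nat.cast_pos.2 hp)).ne'

theorem curveLength_le_curveLength_iff (hp : 0 < p) (c d : ℝ → Matrix (Fin p) (Fin p) 𝕂) :
    curveLength c ≤ curveLength d ↔
      ∫ t in (0 : ℝ)..1, ‖deriv c t‖ ≤ ∫ t in (0 : ℝ)..1, ‖deriv d t‖ := by
  have h : ∀ c : ℝ → Matrix (Fin p) (Fin p) 𝕂,
      curveLength c = (∫ t in (0 : ℝ)..1, ‖deriv c t‖) / √(p : ℝ) := fun c =>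
    intervalIntegral.integral_div _ _
  rw [h, h, div_le_div_iff_of_pos_right (Real.sqrt_pos.2 (Nat.cast_pos.2 hp))]

theorem isShortestGeodesic_iff (hp : 0 < p) {P : Set (Matrix (Fin p) (Fin p) 𝕂)}
    {o q : Matrix (Fin p) (Fin p) 𝕂} {γ : ℝ → Matrix (Fin p) (Fin p) 𝕂} :
    IsShortestGeodesic P o q γ ↔ IsMinimizingGeodesic P o q γ := by
  have h0 : (0 : ℝ) ∈ Icc (0 : ℝ) 1 := ⟨le_rfl, zero_le_one⟩
  refine and_congr Iff.rfl (and_congr ?_ (forall_congr' fun c => forall_congr' fun _ =>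
    curveLength_le_curveLength_iff hp _ _))
  constructor
  · rintro ⟨v, hv⟩
    exact ⟨‖deriv γ 0‖, fun t ht =>
      (speed_eq_speed_iff hp _ _ _ _).1 ((hv t ht).trans (hv 0 h0).symm)⟩
  · rintro ⟨v, hv⟩
    exact ⟨speed γ 0, fun t ht =>
      (speed_eq_speed_iff hp _ _ _ _).2 ((hv t ht).trans (hv 0 h0).symm)⟩

theorem midpointSet_eq (hp : 0 < p) (P : Set (Matrix (Fin p) (Fin p) 𝕂))
    (o q : Matrix (Fin p) (Fin p) 𝕂) : midpointSet P o q = geodesicMidpoints P o q := by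
  ext m
  exact exists_congr fun γ => and_congr (isShortestGeodesic_iff hp) Iff.rfl

theorem isSymmetryAt_iff (hp : 0 < p) {P : Set (Matrix (Fin p) (Fin p) 𝕂)}
    {o : Matrix (Fin p) (Fin p) 𝕂} {s : Matrix (Fin p) (Fin p) 𝕂 → Matrix (Fin p) (Fin p) 𝕂} :
    IsSymmetryAt P o s ↔ IsGeodesicSymmetryAt P o s :=
  ⟨fun h => ⟨h.smooth, h.mapsTo, h.involutive, fun c hc hcP t ht =>
      (speed_eq_speed_iff hp _ _ _ _).1 (h.isometry c hc hcP t ht), h.mem, h.fixed, h.isolated⟩,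
    fun h => ⟨h.smooth, h.mapsTo, h.involutive, fun c hc hcP t ht =>
      (speed_eq_speed_iff hp _ _ _ _).2 (h.isometry c hc hcP t ht), h.mem, h.fixed, h.isolated⟩⟩

theorem isMinimalCentriole_iff (hp : 0 < p) {P C : Set (Matrix (Fin p) (Fin p) 𝕂)}
    {o q : Matrix (Fin p) (Fin p) 𝕂} : IsMinimalCentriole P o q C ↔ AreSymmetryPoles P o q ∧
      ∃ m ∈ geodesicMidpoints P o q, C = connectedComponentIn (geodesicMidpoints P o q) m := by
  rw [IsMinimalCentriole, ArePoles, AreSymmetryPoles, midpointSet_eq hp]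
  simp only [isSymmetryAt_iff hp]

end Transfer

/-! ### Clifford representations as anticommuting complex structures. -/

section CliffordRelations

variable {𝕂 : Type*} [NormedRing 𝕂] [NormedAlgebra ℝ 𝕂] {p k : ℕ}

theorem cliffordForm_single (i : Fin k) : cliffordForm k (Pi.single i 1) = -1 := by
  rw [cliffordForm, QuadraticMap.weightedSumSquares_apply, Finset.sum_eq_single i]
  · simp
  · intro j _ hj
    simp [hj]
  · simp

theorem polar_cliffordForm_single {i j : Fin k} (h : i ≠ j) :
    QuadraticMap.polar (cliffordForm k) (Pi.single i 1) (Pi.single j 1) = 0 := by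
  rw [QuadraticMap.polar, cliffordForm, QuadraticMap.weightedSumSquares_apply,
    QuadraticMap.weightedSumSquares_apply, QuadraticMap.weightedSumSquares_apply,
    ← Finset.sum_sub_distrib, ← Finset.sum_sub_distrib]
  refine Finset.sum_eq_zero fun l _ => ?_
  by_cases hi : l = i
  · subst hi
    simp [h]
  · simp [hi]

theorem isCliffordRep_iff {J : Fin k → Matrix (Fin p) (Fin p) 𝕂} :
    IsCliffordRep J ↔ (∀ i, J i * J i = -1) ∧ ∀ i j, i ≠ j → J i * J j = -(J j * J i) := by
  constructor
  · rintro ⟨ρ, hρ⟩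
    refine ⟨fun i => ?_, fun i j hij => ?_⟩
    · rw [← hρ, ← map_mul, CliffordAlgebra.ι_sq_scalar, cliffordForm_single]
      simp
    · rw [← hρ, ← hρ, ← map_mul ρ, ← map_mul ρ]
      refine eq_neg_of_add_eq_zero_left ?_
      rw [← map_add, CliffordAlgebra.ι_mul_ι_add_swap, polar_cliffordForm_single hij]
      simp
  · rintro ⟨h1, h2⟩
    have hJ : ∀ i j, J i * J j + J j * J i = if i = j then (-2 : ℝ) • 1 else 0 := fun i j => by
      by_cases h : i = j
      · subst h
        rw [if_pos rfl, h1, ← two_smul ℝ, smul_neg, neg_smul]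
      · rw [if_neg h, h2 i j h, neg_add_cancel]
    have hsq : ∀ v : Fin k → ℝ, Fintype.linearCombination ℝ J v * Fintype.linearCombination ℝ J v =
        algebraMap ℝ _ (cliffordForm k v) := by
      intro v
      have e1 : Fintype.linearCombination ℝ J v * Fintype.linearCombination ℝ J v =
          ∑ i, ∑ j, (v i * v j) • (J i * J j) := by
        rw [Fintype.linearCombination_apply, Finset.sum_mul_sum]
        simp only [smul_mul_smul_comm]
      have e2 : ∑ i, ∑ j, (v i * v j) • (J i * J j) = ∑ i, ∑ j, (v i * v j) • (J j * J i) := by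
        rw [Finset.sum_comm]
        exact Finset.sum_congr rfl fun i _ => Finset.sum_congr rfl fun j _ => by
          rw [mul_comm (v j)]
      -- Doubling and adding the sum with exchanged indices leaves only anticommutators, which
      -- vanish off the diagonal. The square identity is what the universal property of `Cl k`
      -- requires.
      have e3 : (2 : ℝ) • ∑ i, ∑ j, (v i * v j) • (J i * J j) =
          (2 : ℝ) • algebraMap ℝ _ (cliffordForm k v) := by
        rw [two_smul]
        nth_rewrite 2 [e2]
        simp only [← Finset.sum_add_distrib, ← smul_add, hJ, smul_ite, smul_zero,
          Finset.sum_ite_eq, Finset.mem_univ, if_true]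
        rw [cliffordForm, QuadraticMap.weightedSumSquares_apply, Algebra.algebraMap_eq_smul_one,
          Finset.sum_smul, Finset.smul_sum]
        refine Finset.sum_congr rfl fun i _ => ?_
        rw [smul_smul, smul_smul]
        congr 1
        simp
        ring
      rw [e1]
      exact smul_right_injective _ (two_ne_zero (α := ℝ)) e3
    exact ⟨CliffordAlgebra.lift _ ⟨Fintype.linearCombination ℝ J, hsq⟩, fun i => by simp⟩

end CliffordRelations

/-! ### Induction along the chain. -/

section Chain

theorem anticommutingStructures_eq_complexStructures {𝕂 : Type*} [NormedRing 𝕂] {p k : ℕ}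
    (G : Set (Matrix (Fin p) (Fin p) 𝕂))
    (J : Fin k → Matrix (Fin p) (Fin p) 𝕂) (i : Fin k) :
    anticommutingStructures G J i = complexStructures G fun l : {l : Fin k // l < i} => J l := by
  ext X
  simp [anticommutingStructures, complexStructures]

variable {𝕂 : Type*} [NormedRing 𝕂] [NormedAlgebra ℝ 𝕂] [StarRing 𝕂] [StarModule ℝ 𝕂]
  [TraceNorm 𝕂] [FiniteDimensional ℝ 𝕂] [NoZeroDivisors 𝕂] [Nontrivial 𝕂] {p k : ℕ}

/-- The step of a chain of minimal centrioles, if all previous steps are components of sets of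
anticommuting structures. -/
theorem centriole_step_iff (hp : 0 < p) {G : Set (Matrix (Fin p) (Fin p) 𝕂)} (hG : IsExpClosed G)
    {P : Fin (k + 1) → Set (Matrix (Fin p) (Fin p) 𝕂)} {J : Fin k → Matrix (Fin p) (Fin p) 𝕂}
    (h0 : P 0 = G) (i : Fin k)
    (hprev : ∀ l < i, J l ∈ anticommutingStructures G J l ∧
      P l.succ = connectedComponentIn (anticommutingStructures G J l) (J l)) :
    (J i ∈ P i.succ ∧ ∃ q, IsMinimalCentriole (P i.castSucc)
      ((Fin.cons 1 J : Fin (k + 1) → Matrix (Fin p) (Fin p) 𝕂) i.castSucc) q (P i.succ)) ↔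
    J i ∈ anticommutingStructures G J i ∧
      P i.succ = connectedComponentIn (anticommutingStructures G J i) (J i) := by
  have : Nonempty (Fin p) := ⟨⟨0, hp⟩⟩
  have hprime : ∀ a b : Matrix (Fin p) (Fin p) 𝕂, a ≠ 0 → b ≠ 0 → ∃ m, a * m * b ≠ 0 :=
    fun _ _ => exists_mul_mul_ne_zero
  simp only [isMinimalCentriole_iff hp]
  rcases i with ⟨_ | n, hi⟩
  · have hN : anticommutingStructures G J ⟨0, hi⟩ = {X | X ∈ G ∧ X * X = -1} := by
      ext X
      refine ⟨fun h => ⟨h.1, h.2.1⟩, fun h => ⟨h.1, h.2, fun l hl => ?_⟩⟩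
      exact absurd hl (Nat.not_lt_zero _)
    rw [hN]
    have e : (⟨0, hi⟩ : Fin k).castSucc = 0 := rfl
    rw [e, Fin.cons_zero, h0]
    exact hG.minimalCentriole_iff hprime
  -- The space at step n + 1 is the component through `J n`, for the family of J l with l < n;
  -- anticommuting also with `J n` gives the condition for all l < n + 1.
  · have hn : n < k := (Nat.lt_succ_self n).trans hi
    have e : (⟨n + 1, hi⟩ : Fin k).castSucc = (⟨n, hn⟩ : Fin k).succ := rfl
    rw [e, Fin.cons_succ]
    obtain ⟨ho, hP⟩ := hprev ⟨n, hn⟩ (Nat.lt_succ_self n)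
    have hlt : ∀ l : {l : Fin k // l < ⟨n, hn⟩}, J l ∈ anticommutingStructures G J l := fun l =>
      (hprev l (l.2.trans (Nat.lt_succ_self n))).1
    rw [anticommutingStructures_eq_complexStructures] at ho hP
    refine hG.minimalCentriole_component_iff hprime ho
      (fun l => star_eq_neg_of_mul_self (hG.star_mul_self _ (hlt l).1) (hlt l).2.1)
      (fun l => (hlt l).2.1) (fun l l' hll => ?_) hP ?_
    · rcases lt_or_gt_of_ne (fun h => hll (Subtype.ext h) : (l : Fin k) ≠ l') with h | h
      · rw [(hlt l').2.2 l h, neg_neg]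
      · exact (hlt l).2.2 l' h
    · ext X
      rw [← anticommutingStructures_eq_complexStructures]
      constructor
      · rintro ⟨h1, h2, h3⟩
        exact ⟨⟨h1, h2, fun l hl => h3 l (hl.trans (Nat.lt_succ_self n))⟩,
          h3 _ (Nat.lt_succ_self n)⟩
      · rintro ⟨⟨h1, h2, h3⟩, h4⟩
        refine ⟨h1, h2, fun l hl => ?_⟩
        rcases Nat.lt_succ_iff_lt_or_eq.1 (show (l : ℕ) < n + 1 from hl) with h | h
        · exact h3 l h
        · rwa [show l = ⟨n, hn⟩ from Fin.ext h]

/-- Strong induction is needed, since a step uses the Clifford relations among all earlier base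
points. Relations for l < i give those for all distinct pairs by symmetry. -/
theorem isCentrioleChain_iff (hp : 0 < p) {G : Set (Matrix (Fin p) (Fin p) 𝕂)}
    (hG : IsExpClosed G) (P : Fin (k + 1) → Set (Matrix (Fin p) (Fin p) 𝕂))
    (J : Fin k → Matrix (Fin p) (Fin p) 𝕂) :
    IsCentrioleChain G P J ↔ IsCliffordRep J ∧ (∀ i, J i ∈ G) ∧ P 0 = G ∧
      ∀ i : Fin k, P i.succ = connectedComponentIn (anticommutingStructures G J i) (J i) := by
  rw [isCliffordRep_iff]
  constructor
  · rintro ⟨h0, h⟩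
    have key : ∀ i : Fin k, J i ∈ anticommutingStructures G J i ∧
        P i.succ = connectedComponentIn (anticommutingStructures G J i) (J i) := by
      intro i
      induction i using WellFoundedLT.induction with
      | _ i ih => exact (centriole_step_iff hp hG h0 i ih).1 (h i)
    refine ⟨⟨fun i => (key i).1.2.1, fun i j hij => ?_⟩, fun i => (key i).1.1, h0,
      fun i => (key i).2⟩
    rcases lt_or_gt_of_ne hij with h | h
    · rw [(key j).1.2.2 i h, neg_neg]
    · exact (key i).1.2.2 j h
  · rintro ⟨⟨h1, h2⟩, hJ, h0, h⟩
    have key : ∀ i : Fin k, J i ∈ anticommutingStructures G J i ∧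
        P i.succ = connectedComponentIn (anticommutingStructures G J i) (J i) := fun i =>
      ⟨⟨hJ i, h1 i, fun l hl => h2 i l hl.ne'⟩, h i⟩
    exact ⟨h0, fun i => (centriole_step_iff hp hG h0 i fun l _ => key l).2 (key i)⟩

end Chain

/-! ### The groups SO, U and Sp. -/

section ClassicalGroups

open NormedSpace (exp)

theorem isExpClosed_unitary {M : Type*} [NormedRing M] [NormedAlgebra ℝ M] [StarRing M]
    [TraceNorm M] [CompleteSpace M] : IsExpClosed (unitary M : Set M) where
  star_mul_self _ ha := ha.1
  mul_star_self _ ha := ha.2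
  mul_mem _ ha _ hb := mul_mem ha hb
  star_mem _ ha := Unitary.star_mem ha
  exp_mem _ hA := ⟨star_exp_mul_self hA, exp_mul_star_self hA⟩

noncomputable instance traceNormReal : TraceNorm ℝ where
  tr := LinearMap.id
  tr_mul_comm x y := by simp [mul_comm]
  tr_star x := by simp
  norm_sq_eq x := by simp [sq]

noncomputable instance traceNormComplex : TraceNorm ℂ where
  tr := Complex.reLm
  tr_mul_comm x y := by rw [mul_comm]
  tr_star x := by simp
  norm_sq_eq x := by
    rw [Complex.sq_norm, Complex.normSq_apply]
    simp

noncomputable instance traceNormQuaternion : TraceNorm ℍ[ℝ] where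
  tr :=
    { toFun := fun x => x.re
      map_add' := Quaternion.re_add
      map_smul' := fun r x => Quaternion.re_smul x r }
  tr_mul_comm x y := by
    change (x * y).re = (y * x).re
    rw [Quaternion.re_mul, Quaternion.re_mul]
    ring
  tr_star x := Quaternion.re_star x
  norm_sq_eq x := by
    rw [sq, ← Quaternion.normSq_eq_norm_mul_self, Quaternion.normSq_def']
    change _ = (star x * x).re
    rw [Quaternion.re_mul, Quaternion.re_star, Quaternion.imI_star, Quaternion.imJ_star,
      Quaternion.imK_star]
    ring

instance : StarModule ℝ ℍ[ℝ] where
  star_smul r x := Quaternion.star_smul r x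

theorem isExpClosed_SO (p : ℕ) : IsExpClosed (SO p) := by
  have hU := isExpClosed_unitary (M := Matrix (Fin p) (Fin p) ℝ)
  have hdet : ∀ A : Matrix (Fin p) (Fin p) ℝ, star A * A = 1 → A.det * A.det = 1 := fun A hA => by
    have := congr_arg Matrix.det hA
    rwa [Matrix.det_mul, Matrix.star_eq_conjTranspose, Matrix.det_conjTranspose, star_trivial,
      Matrix.det_one] at this
  have hmem : ∀ A, A ∈ SO p ↔ A ∈ unitary (Matrix (Fin p) (Fin p) ℝ) ∧ A.det = 1 := fun A =>
    Matrix.mem_specialOrthogonalGroup_iff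
  refine ⟨fun a ha => ((hmem a).1 ha).1.1, fun a ha => ((hmem a).1 ha).1.2, fun a ha b hb => ?_,
    fun a ha => ?_, fun A hA => ?_⟩
  · rw [hmem] at *
    exact ⟨mul_mem ha.1 hb.1, by rw [Matrix.det_mul, ha.2, hb.2, one_mul]⟩
  · rw [hmem] at *
    exact ⟨Unitary.star_mem ha.1, by
      rw [Matrix.star_eq_conjTranspose, Matrix.det_conjTranspose, ha.2, star_trivial]⟩
  · rw [hmem]
    refine ⟨hU.exp_mem A hA, ?_⟩
    -- The determinant of exp A is the square of that of the orthogonal matrix exp(A/2), hence 1.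
    have h := exp_add_smul (1 / 2) (1 / 2) A
    rw [add_halves, one_smul] at h
    rw [h, Matrix.det_mul]
    exact hdet _ (star_exp_mul_self (star_smul_of_skew hA _))

end ClassicalGroups

end Centriole

theorem theorem3p1 (p : ℕ) (hp : 0 < p) (k : ℕ) :
    (Even p → ∀ (P : Fin (k + 1) → Set (Matrix (Fin p) (Fin p) ℝ))
        (J : Fin k → Matrix (Fin p) (Fin p) ℝ),
      Centriole.IsCentrioleChain (Centriole.SO p) P J ↔
        Centriole.IsCliffordRep J ∧ (∀ i, J i ∈ Centriole.SO p) ∧ P 0 = Centriole.SO p ∧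
        ∀ i : Fin k, P i.succ = connectedComponentIn
          (Centriole.anticommutingStructures (Centriole.SO p) J i) (J i)) ∧
    (∀ (P : Fin (k + 1) → Set (Matrix (Fin p) (Fin p) ℂ))
        (J : Fin k → Matrix (Fin p) (Fin p) ℂ),
      Centriole.IsCentrioleChain (Centriole.U p) P J ↔
        Centriole.IsCliffordRep J ∧ (∀ i, J i ∈ Centriole.U p) ∧ P 0 = Centriole.U p ∧
        ∀ i : Fin k, P i.succ = connectedComponentIn
          (Centriole.anticommutingStructures (Centriole.U p) J i) (J i)) ∧
    (∀ (P : Fin (k + 1) → Set (Matrix (Fin p) (Fin p) (Quaternion ℝ)))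
        (J : Fin k → Matrix (Fin p) (Fin p) (Quaternion ℝ)),
      Centriole.IsCentrioleChain (Centriole.Sp p) P J ↔
        Centriole.IsCliffordRep J ∧ (∀ i, J i ∈ Centriole.Sp p) ∧ P 0 = Centriole.Sp p ∧
        ∀ i : Fin k, P i.succ = connectedComponentIn
          (Centriole.anticommutingStructures (Centriole.Sp p) J i) (J i)) := by
  refine ⟨fun _ P J => ?_, fun P J => ?_, fun P J => ?_⟩
  · exact Centriole.isCentrioleChain_iff hp (Centriole.isExpClosed_SO p) P J
  · exact Centriole.isCentrioleChain_iff hp Centriole.isExpClosed_unitary P J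
  · exact Centriole.isCentrioleChain_iff hp Centriole.isExpClosed_unitary P J
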